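/- Let $\mathbf C$ be a category. A zigzag $Z$ of length $n\ge 0$ in $\mathbf C$ is a diagram $r_0\xrightarrow{f_0}s_0\xleftarrow{b_0}r_1\xrightarrow{f_1}s_1\leftarrow\cdots\rightarrow s_{n-1}\xleftarrow{b_{n-1}}r_n$; $r_0,\dots,r_n$ are its regular objects, $s_0,\dots,s_{n-1}$ its singular objects, $[n]=\{0<\dots<n-1\}$ is its ordinal of singular heights and $[n+1]$ its ordinal of regular heights. Let $\Delta$ be the category of all finite ordinals $[n]$, $n\ge 0$, and monotone maps. The reversal of a monotone map $g:[n]\to[m]$ is $g':[m+1]\to[n+1]$, $g'(j)=\min\big(\{i\in[n] : g(i)\ge j\}\cup\{n\}\big)$. A zigzag map $g:Z\to Z'$ consists of a monotone map $g_{\mathrm{sing}}$ between the ordinals of singular heights and of morphisms $g_i:s_i\to s'_{g_{\mathrm{sing}}(i)}$, such that, with $g_{\mathrm{reg}}=(g_{\mathrm{sing}})'$, one has $r'_j=r_{g_{\mathrm{reg}}(j)}$ for all regular heights $j$ of $Z'$ and the planar diagram formed by $Z$, $Z'$, the morphisms $g_i$ and the identities $r'_j=r_{g_{\mathrm{reg}}(j)}$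 commutes. Zigzags and zigzag maps form the zigzag category $Z_{\mathbf C}$, and $S:Z_{\mathbf C}\to\Delta$ sends $Z$ to its ordinal of singular heights and $g$ to $g_{\mathrm{sing}}$. For regular heights $a\le b$ of $Z$, $Z_{(a,b)}$ is the part of $Z$ from $r_a$ to $r_b$; zigzag maps $Z\to Z'$ restrict to maps $Z_{(g_{\mathrm{reg}}(a),g_{\mathrm{reg}}(b))}\to Z'_{(a,b)}$. The deconstruction $K^*$ of a diagram $K:\mathbf J\to Z_{\mathbf C}$ is the diagram in $\mathbf C$ whose vertices are the pairs of an object $j$ of $\mathbf J$ and a regular or singular height of $K(j)$, whose objects are the corresponding objects of $K(j)$, and whose arrows are generated by the forward and backward morphisms of all $K(j)$ and, for every $\varphi:j\to j'$ in $\mathbf J$, by the morphisms $K(\varphi)_i$ between singular objects and the identities from $r_i^{K(j')}$ to $r^{K(j)}_{K(\varphi)_{\mathrm{reg}}(i)}$. Let $D:\mathbf J\to Z_{\mathbf C}$ be a non-empty connected diagram. Consider the following procedure. 1. Take a colimit $[c]$ of $S\circ D$ in $\Delta$, with cocone $c_j:S(D(j))\to[c]$; fail if there is none. 2. For each $k\in[c]$,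 let $D_k:\mathbf J\to Z_{\mathbf C}$ be the restricted diagram $D_k(j)=D(j)_{(c_j'(k),\,c_j'(k+1))}$. Take a colimit $p_k$ in $\mathbf C$ of the deconstruction $(D_k)^*$, with legs $p^j_{k,i}:s_i^{D_k(j)}\to p_k$ at the singular heights; fail if there is none. Choose $j$ such that $D_k(j)$ has length $m>0$, and let $C_k$ be the length-one zigzag with singular object $p_k$, forward morphism $p^j_{k,0}\circ f_0^{D_k(j)}$ and backward morphism $p^j_{k,m-1}\circ b_{m-1}^{D_k(j)}$. 3. Let $C$ be the concatenation of the zigzags $C_k$, $k\in[c]$ (if $c=0$, the zigzag of length $0$ on the common regular object of all $D(j)$), and let $f^j:D(j)\to C$ be the zigzag map with $(f^j)_{\mathrm{sing}}=c_j$ whose morphisms between singular objects are the legs $p^j_{k,i}$. **Theorem.** Let $\mathbf C$ be a category with a terminal object and let $D:\mathbf J\to Z_{\mathbf C}$ be a non-empty connected diagram. Then $D$ has a colimit if and only if the procedure succeeds, that is, if and only if the colimit of $S\circ D$ in $\Delta$ and then, for every $k\in[c]$, the colimit of $(D_k)^*$ in $\mathbf C$ exist. Whenever these colimits exist, the procedure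 can be carried out, and, whatever choices are made in it, the maps $f^j:D(j)\to C$ that it constructs form a colimit cocone of $D$. -/

import Mathlib

open CategoryTheory CategoryTheory.Limits

/-- The category of finite ordinals `[n] = {0 < ⋯ < n - 1}`, for all `n ≥ 0` (the empty ordinal
`[0]` is included), and monotone maps. -/
structure Delta where
  /-- the number of elements -/
  len : ℕ

namespace Delta

/-- Morphisms of `Delta` are monotone maps. -/
@[ext]
structure Hom (a b : Delta) where
  /-- the underlying monotone map -/
  map : Fin a.len →o Fin b.len

instance : Category Delta where
  Hom := Hom
  id _ := ⟨OrderHom.id⟩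
  comp f g := ⟨g.map.comp f.map⟩

/-- The monotone map `[n + 1] → [m + 1]` extending `f : [n] → [m]` that sends the new top element
to the new top element. -/
def addTop {n m : ℕ} (f : Fin n →o Fin m) : Fin (n + 1) → Fin (m + 1) :=
  Fin.lastCases (Fin.last _) fun i => (f i).castSucc

@[simp] theorem addTop_castSucc {n m : ℕ} (f : Fin n →o Fin m) (i : Fin n) :
    addTop f i.castSucc = (f i).castSucc := by simp [addTop]

@[simp] theorem addTop_last {n m : ℕ} (f : Fin n →o Fin m) :
    addTop f (Fin.last _) = Fin.last _ := by simp [addTop]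

/-- The reversal of a monotone map `f : [n] → [m]`: the map `[m + 1] → [n + 1]` that sends `j` to
the least `x` with `j ≤ (addTop f) x`. -/
def rev {n m : ℕ} (f : Fin n →o Fin m) (j : Fin (m + 1)) : Fin (n + 1) :=
  (Finset.univ.filter fun x => j ≤ addTop f x).min' ⟨Fin.last _, by simp [Fin.le_last]⟩

theorem addTop_mono {n m : ℕ} (f : Fin n →o Fin m) : Monotone (addTop f) := by
  intro x y h
  induction y using Fin.lastCases with
  | last => simp [Fin.le_last]
  | cast y =>
    induction x using Fin.lastCases with
    | last => exact absurd h (by simp)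
    | cast x =>
      simp only [addTop_castSucc, Fin.castSucc_le_castSucc_iff] at h ⊢
      exact f.monotone h

theorem rev_le_iff {n m : ℕ} (f : Fin n →o Fin m) (j : Fin (m + 1)) (x : Fin (n + 1)) :
    rev f j ≤ x ↔ j ≤ addTop f x := by
  constructor
  · intro h
    have := Finset.min'_mem (Finset.univ.filter fun x => j ≤ addTop f x)
      ⟨Fin.last _, by simp [Fin.le_last]⟩
    exact (Finset.mem_filter.mp this).2.trans (addTop_mono f h)
  · intro h
    exact Finset.min'_le _ _ (by simpa using h)

theorem rev_le_castSucc {n m : ℕ} (f : Fin n →o Fin m) (j : Fin (m + 1)) (i : Fin n) :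
    (rev f j).val ≤ i.val ↔ j.val ≤ (f i).val := by
  have := rev_le_iff f j i.castSucc
  simpa [Fin.le_def] using this

theorem lt_rev {n m : ℕ} (f : Fin n →o Fin m) (j : Fin (m + 1)) (i : Fin n) :
    i.val < (rev f j).val ↔ (f i).val < j.val := by
  have := rev_le_castSucc f j i
  omega

theorem rev_mono {n m : ℕ} (f : Fin n →o Fin m) : Monotone (rev f) := by
  intro x y h
  rw [rev_le_iff]
  exact h.trans ((rev_le_iff f y _).1 le_rfl)

@[simp] theorem rev_id (n : ℕ) (j : Fin (n + 1)) : rev (OrderHom.id : Fin n →o Fin n) j = j := by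
  refine eq_of_forall_ge_iff fun x => ?_
  rw [rev_le_iff]
  induction x using Fin.lastCases <;> simp

theorem rev_comp {n m l : ℕ} (f : Fin n →o Fin m) (g : Fin m →o Fin l) (j : Fin (l + 1)) :
    rev (g.comp f) j = rev f (rev g j) := by
  refine eq_of_forall_ge_iff fun x => ?_
  rw [rev_le_iff, rev_le_iff, rev_le_iff]
  induction x using Fin.lastCases <;> simp

end Delta

universe v u v₁ u₁

/-- A zigzag `r 0 ⟶ s 0 ⟵ r 1 ⟶ s 1 ⟵ ⋯ ⟶ s (n - 1) ⟵ r n` in a category, of length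
`n = len ≥ 0`. -/
structure ZigzagIn (C : Type u) [Category.{v} C] where
  /-- the length: the number of singular heights -/
  len : ℕ
  /-- the regular objects -/
  r : Fin (len + 1) → C
  /-- the singular objects -/
  s : Fin len → C
  /-- the forward morphisms -/
  f : ∀ i, r i.castSucc ⟶ s i
  /-- the backward morphisms -/
  b : ∀ i, r i.succ ⟶ s i

namespace ZigzagIn

variable {C : Type u} [Category.{v} C]

/-- The ordinal of singular heights of a zigzag. -/
abbrev singHeights (Z : ZigzagIn C) : Delta := ⟨Z.len⟩

/-- A zigzag map `Z ⟶ Z'`: a monotone map `sing` on singular heights, and for each singular height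
`i` of `Z`, with image `k = sing i`, a morphism `app i k _ : Z.s i ⟶ Z'.s k`. The regular objects
are required to be equal along the reversal of `sing`, and the resulting planar diagram to
commute. Its squares are: those between `r' k` and `r' (k + 1)` for a height `k` not in the image
of `sing` (`comm_empty`), those at the first and at the last height of a fibre of `sing`
(`comm_first`, `comm_last`), and those between two adjacent heights of a fibre (`comm_mid`). -/
structure Hom (Z Z' : ZigzagIn C) where
  /-- the monotone map on singular heights -/
  sing : Fin Z.len →o Fin Z'.len
  /-- the morphisms between singular objects -/
  app : ∀ (i : Fin Z.len) (k : Fin Z'.len), sing i = k → (Z.s i ⟶ Z'.s k)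
  reg_eq : ∀ x : Fin (Z'.len + 1), Z'.r x = Z.r (Delta.rev sing x)
  comm_empty : ∀ (k : Fin Z'.len)
    (h : Delta.rev sing k.castSucc = Delta.rev sing k.succ),
    Z'.f k = eqToHom ((reg_eq _).trans ((congrArg Z.r h).trans (reg_eq _).symm)) ≫ Z'.b k
  comm_first : ∀ (i : Fin Z.len) (k : Fin Z'.len) (hik : sing i = k)
    (h : Delta.rev sing k.castSucc = i.castSucc),
    Z'.f k = eqToHom ((reg_eq _).trans (congrArg Z.r h)) ≫ Z.f i ≫ app i k hik
  comm_last : ∀ (i : Fin Z.len) (k : Fin Z'.len) (hik : sing i = k)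
    (h : Delta.rev sing k.succ = i.succ),
    Z'.b k = eqToHom ((reg_eq _).trans (congrArg Z.r h)) ≫ Z.b i ≫ app i k hik
  comm_mid : ∀ (i j : Fin Z.len) (k : Fin Z'.len) (hik : sing i = k) (hjk : sing j = k)
    (h : i.succ = j.castSucc),
    Z.b i ≫ app i k hik = eqToHom (congrArg Z.r h) ≫ Z.f j ≫ app j k hjk

theorem Hom.ext_app {Z Z' : ZigzagIn C} (g g' : Hom Z Z') (h : ∀ i, g.sing i = g'.sing i)
    (h' : ∀ i k hk hk', g.app i k hk = g'.app i k hk') : g = g' := by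
  obtain ⟨σ, a, _, _, _, _, _⟩ := g
  obtain ⟨σ', a', _, _, _, _, _⟩ := g'
  obtain rfl : σ = σ' := OrderHom.ext _ _ (funext h)
  obtain rfl : a = a' := by
    funext i k hk
    exact h' i k hk hk
  rfl

/-- The identity zigzag map. -/
def Hom.id (Z : ZigzagIn C) : Hom Z Z where
  sing := OrderHom.id
  app i k h := eqToHom (congrArg Z.s h)
  reg_eq x := by simp
  comm_empty k h := by
    simp [Fin.ext_iff] at h
  comm_first i k hik h := by
    obtain rfl : i = k := hik
    simp
  comm_last i k hik h := by
    obtain rfl : i = k := hik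
    simp
  comm_mid i j k hik hjk h := by
    obtain rfl : i = k := hik
    obtain rfl : j = i := hjk
    simp [Fin.ext_iff] at h

section comp

variable {Z Z₁ Z₂ : ZigzagIn C} (g : Hom Z Z₁) (h : Hom Z₁ Z₂)

theorem Hom.chain (l : Fin Z₂.len) (d : ℕ) : ∀ (y z : Fin Z₁.len) (_ : y.val + d = z.val)
    (hy : h.sing y = l) (hz : h.sing z = l)
    (e : Delta.rev g.sing y.castSucc = Delta.rev g.sing z.castSucc),
    Z₁.f y ≫ h.app y l hy =
      eqToHom ((g.reg_eq _).trans ((congrArg Z.r e).trans (g.reg_eq _).symm)) ≫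
        Z₁.f z ≫ h.app z l hz := by
  induction d with
  | zero =>
    intro y z hd hy hz e
    obtain rfl : y = z := Fin.ext (by omega)
    simp
  | succ d ih =>
    intro y z hd hy hz e
    let w : Fin Z₁.len := ⟨y.val + 1, by have := z.2; omega⟩
    have hyw : y ≤ w := by simp [w, Fin.le_def]
    have hwz : w ≤ z := by simp [w, Fin.le_def]; omega
    have hw : h.sing w = l :=
      le_antisymm (hz ▸ h.sing.monotone hwz) (hy ▸ h.sing.monotone hyw)
    have hs : y.succ = w.castSucc := rfl
    have e1 : Delta.rev g.sing y.castSucc = Delta.rev g.sing w.castSucc :=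
      le_antisymm (Delta.rev_mono _ (by simpa using hyw))
        (e ▸ Delta.rev_mono _ (by simpa using hwz))
    have e2 := e1.symm.trans e
    rw [g.comm_empty y (by rw [hs]; exact e1), Category.assoc, h.comm_mid y w l hy hw hs,
      ih w z (by simp [w]; omega) hw hz e2]
    simp

theorem Hom.chain_last (l : Fin Z₂.len) (y z : Fin Z₁.len) (hyz : y ≤ z)
    (hy : h.sing y = l) (hz : h.sing z = l)
    (e : Delta.rev g.sing y.succ = Delta.rev g.sing z.succ) :
    Z₁.b y ≫ h.app y l hy =
      eqToHom ((g.reg_eq _).trans ((congrArg Z.r e).trans (g.reg_eq _).symm)) ≫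
        Z₁.b z ≫ h.app z l hz := by
  rcases hyz.eq_or_lt with rfl | hlt
  · simp
  · let w : Fin Z₁.len := ⟨y.val + 1, by have := z.2; have : y.val < z.val := hlt; omega⟩
    have hyw : y ≤ w := by simp [w, Fin.le_def]
    have hwz : w ≤ z := by have : y.val < z.val := hlt; simp [w, Fin.le_def]; omega
    have hw : h.sing w = l :=
      le_antisymm (hz ▸ h.sing.monotone hwz) (hy ▸ h.sing.monotone hyw)
    have hs : y.succ = w.castSucc := rfl
    have m1 : Delta.rev g.sing w.castSucc ≤ Delta.rev g.sing z.castSucc :=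
      Delta.rev_mono _ (by simpa using hwz)
    have m2 : Delta.rev g.sing z.castSucc ≤ Delta.rev g.sing z.succ :=
      Delta.rev_mono _ (Fin.castSucc_lt_succ).le
    have e1 : Delta.rev g.sing w.castSucc = Delta.rev g.sing z.castSucc :=
      le_antisymm m1 (by rw [← hs, e]; exact m2)
    have e2 : Delta.rev g.sing z.castSucc = Delta.rev g.sing z.succ := by
      rw [← e1, ← hs, e]
    rw [h.comm_mid y w l hy hw hs,
      Hom.chain g h l (z.val - w.val) w z (by have : w.val ≤ z.val := hwz; omega) hw hz e1,
      g.comm_empty z e2]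
    simp

/-- The composite of two zigzag maps. -/
def Hom.comp : Hom Z Z₂ where
  sing := h.sing.comp g.sing
  app i l hl := g.app i (g.sing i) rfl ≫ h.app (g.sing i) l hl
  reg_eq x := by rw [h.reg_eq, g.reg_eq, Delta.rev_comp]
  comm_empty l e := by
    rw [Delta.rev_comp, Delta.rev_comp] at e
    rcases (Delta.rev_mono h.sing (Fin.castSucc_lt_succ (i := l)).le).eq_or_lt with he | hlt
    · exact h.comm_empty l he
    · set A := Delta.rev h.sing l.castSucc with hA
      set B := Delta.rev h.sing l.succ with hB
      have hlt' : A.val < B.val := hlt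
      have hBl := B.2
      let y : Fin Z₁.len := ⟨A.val, by omega⟩
      let z : Fin Z₁.len := ⟨B.val - 1, by omega⟩
      have hyA : A = y.castSucc := rfl
      have hzB : B = z.succ := Fin.ext (by simp [z]; omega)
      have hyz : y ≤ z := by simp [y, z, Fin.le_def]; omega
      have y1 := (Delta.rev_le_castSucc h.sing l.castSucc y).1 (by rw [← hA])
      have z1 := (Delta.lt_rev h.sing l.succ z).1 (by rw [← hB]; change B.val - 1 < B.val; omega)
      have yz1 : (h.sing y).val ≤ (h.sing z).val := h.sing.monotone hyz
      simp only [Fin.val_castSucc, Fin.val_succ] at y1 z1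
      have hy : h.sing y = l := Fin.ext (by omega)
      have hz : h.sing z = l := Fin.ext (by omega)
      have m1 : Delta.rev g.sing y.castSucc ≤ Delta.rev g.sing z.castSucc :=
        Delta.rev_mono _ (by simpa using hyz)
      have m2 : Delta.rev g.sing z.castSucc ≤ Delta.rev g.sing z.succ :=
        Delta.rev_mono _ (Fin.castSucc_lt_succ).le
      rw [hyA, hzB] at e
      have e1 := le_antisymm m1 (e ▸ m2)
      rw [h.comm_first y l hy (hA.symm.trans hyA), h.comm_last z l hz (hB.symm.trans hzB),
        Hom.chain g h l (z.val - y.val) y z (by have : y.val ≤ z.val := hyz; omega) hy hz e1,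
        g.comm_empty z (e1.symm.trans e)]
      simp
  comm_first i l hil e := by
    rw [Delta.rev_comp] at e
    set A := Delta.rev h.sing l.castSucc with hA
    set k := g.sing i with hk
    have hkl : h.sing k = l := hil
    have k1 := (Delta.rev_le_castSucc h.sing l.castSucc k).2 (by rw [hkl]; simp)
    rw [← hA] at k1
    let y : Fin Z₁.len := ⟨A.val, by have := k.2; omega⟩
    have hyA : A = y.castSucc := rfl
    have hyk : y ≤ k := k1
    have y1 := (Delta.rev_le_castSucc h.sing l.castSucc y).1 (by rw [← hA])
    have y2 : (h.sing y).val ≤ (h.sing k).val := h.sing.monotone hyk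
    rw [hkl] at y2
    simp only [Fin.val_castSucc] at y1
    have hy : h.sing y = l := Fin.ext (by omega)
    have m1 : Delta.rev g.sing y.castSucc ≤ Delta.rev g.sing k.castSucc :=
      Delta.rev_mono _ (by simpa using hyk)
    have m2 : Delta.rev g.sing k.castSucc ≤ i.castSucc :=
      (Delta.rev_le_castSucc g.sing k.castSucc i).2 (by simp [← hk])
    rw [hyA] at e
    have e2 : Delta.rev g.sing k.castSucc = i.castSucc := le_antisymm m2 (e ▸ m1)
    rw [h.comm_first y l hy (hA.symm.trans hyA),
      Hom.chain g h l (k.val - y.val) y k (by have : y.val ≤ k.val := hyk; omega) hy hkl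
        (e.trans e2.symm), g.comm_first i k rfl e2]
    simp
    rfl
  comm_last i l hil e := by
    rw [Delta.rev_comp] at e
    set B := Delta.rev h.sing l.succ with hB
    set k := g.sing i with hk
    have hkl : h.sing k = l := hil
    have k1 := (Delta.lt_rev h.sing l.succ k).2 (by rw [hkl]; simp)
    rw [← hB] at k1
    have hBl := B.2
    let z : Fin Z₁.len := ⟨B.val - 1, by omega⟩
    have hzB : B = z.succ := Fin.ext (by simp [z]; omega)
    have hkz : k ≤ z := by simp [z, Fin.le_def]; omega
    have z1 := (Delta.lt_rev h.sing l.succ z).1 (by rw [← hB]; change B.val - 1 < B.val; omega)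
    have z2 : (h.sing k).val ≤ (h.sing z).val := h.sing.monotone hkz
    rw [hkl] at z2
    simp only [Fin.val_succ] at z1
    have hz : h.sing z = l := Fin.ext (by omega)
    have m1 : Delta.rev g.sing k.succ ≤ Delta.rev g.sing z.succ :=
      Delta.rev_mono _ (by simpa using hkz)
    have m2 : i.succ ≤ Delta.rev g.sing k.succ := by
      have := (Delta.lt_rev g.sing k.succ i).2 (by simp [← hk])
      simp only [Fin.le_def, Fin.val_succ]
      omega
    rw [hzB] at e
    have e2 : Delta.rev g.sing k.succ = i.succ := le_antisymm (e ▸ m1) m2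
    have key := Hom.chain_last g h l k z hkz hkl hz (e2.trans e.symm)
    rw [g.comm_last i k rfl e2] at key
    rw [h.comm_last z l hz (hB.symm.trans hzB)]
    simp only [Category.assoc] at key
    rw [(eqToHom_comp_iff _ _ _).1 key.symm]
    simp
    rfl
  comm_mid i j l hil hjl e := by
    have hi : h.sing (g.sing i) = l := hil
    have hj : h.sing (g.sing j) = l := hjl
    have eij : j.val = i.val + 1 := by simpa [Fin.ext_iff] using e.symm
    have hij : i ≤ j := Fin.le_def.2 (by omega)
    rcases (g.sing.monotone hij).eq_or_lt with he | hlt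
    · have := g.comm_mid i j (g.sing j) he rfl e
      have hc : ∀ (k' : Fin Z₁.len) (ek : g.sing i = k') (hk' : h.sing k' = l),
          g.app i _ rfl ≫ h.app _ l hi = g.app i k' ek ≫ h.app k' l hk' := by
        rintro k' rfl _; rfl
      rw [hc _ he hj, ← Category.assoc, this]
      simp
    · set k := g.sing i with hk
      set k' := g.sing j with hk'
      have hlt' : k.val < k'.val := hlt
      let w : Fin Z₁.len := ⟨k.val + 1, by have := k'.2; omega⟩
      have hs : k.succ = w.castSucc := rfl
      have hkw : k ≤ w := by simp [w, Fin.le_def]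
      have hwk : w ≤ k' := by simp [w, Fin.le_def]; omega
      have hw : h.sing w = l :=
        le_antisymm (hj ▸ h.sing.monotone hwk) (hi ▸ h.sing.monotone hkw)
      have m1 : i.succ ≤ Delta.rev g.sing k.succ := by
        have := (Delta.lt_rev g.sing k.succ i).2 (by simp [← hk])
        simp only [Fin.le_def, Fin.val_succ]
        omega
      have m2 : Delta.rev g.sing w.castSucc ≤ Delta.rev g.sing k'.castSucc :=
        Delta.rev_mono _ (by simpa using hwk)
      have m3 : Delta.rev g.sing k'.castSucc ≤ j.castSucc :=
        (Delta.rev_le_castSucc g.sing k'.castSucc j).2 (by simp [← hk'])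
      have e1 : Delta.rev g.sing k.succ = i.succ :=
        le_antisymm (by rw [hs, e]; exact m2.trans m3) m1
      have e3 : Delta.rev g.sing k'.castSucc = j.castSucc :=
        le_antisymm m3 (by rw [← e]; exact m1.trans m2)
      have e2 : Delta.rev g.sing w.castSucc = Delta.rev g.sing k'.castSucc := by
        rw [← hs, e1, e3, e]
      have key := h.comm_mid k w l hi hw hs
      rw [Hom.chain g h l (k'.val - w.val) w k' (by have : w.val ≤ k'.val := hwk; omega) hw hj e2,
        g.comm_last i k rfl e1, g.comm_first j k' rfl e3] at key
      simp only [Category.assoc] at key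
      change Z.b i ≫ g.app i k rfl ≫ h.app k l hi =
        eqToHom _ ≫ Z.f j ≫ g.app j k' rfl ≫ h.app k' l hj
      rw [(eqToHom_comp_iff _ _ _).1 key]
      simp

end comp

theorem Hom.app_eqToHom {Z Z' : ZigzagIn C} (g : Hom Z Z') (i : Fin Z.len) (k k' : Fin Z'.len)
    (hk : g.sing i = k) (e : k = k') :
    g.app i k hk ≫ eqToHom (congrArg Z'.s e) = g.app i k' (hk.trans e) := by
  subst e
  simp

theorem Hom.eqToHom_app {Z Z' : ZigzagIn C} (g : Hom Z Z') (i i' : Fin Z.len) (k : Fin Z'.len)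
    (e : i = i') (hk : g.sing i' = k) :
    eqToHom (congrArg Z.s e) ≫ g.app i' k hk = g.app i k ((congrArg g.sing e).trans hk) := by
  subst e
  simp

/-- The zigzag category. -/
instance : Category (ZigzagIn C) where
  Hom := Hom
  id := Hom.id
  comp g h := g.comp h
  id_comp g := Hom.ext_app _ _ (fun _ => rfl) fun i k hk hk' =>
    Hom.eqToHom_app g i _ k rfl hk'
  comp_id g := Hom.ext_app _ _ (fun _ => rfl) fun i k hk hk' =>
    Hom.app_eqToHom g i _ k rfl hk
  assoc g h l := Hom.ext_app _ _ (fun _ => rfl) fun i k hk hk' => by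
    simp [Hom.comp]
    rfl

theorem hom_ext {Z Z' : ZigzagIn C} (g g' : Z ⟶ Z') (h : ∀ i, g.sing i = g'.sing i)
    (h' : ∀ i k hk hk', g.app i k hk = g'.app i k hk') : g = g' := Hom.ext_app g g' h h'

theorem comp_app {Z Z₁ Z₂ : ZigzagIn C} (g : Z ⟶ Z₁) (h : Z₁ ⟶ Z₂) (i : Fin Z.len)
    (k : Fin Z₁.len) (l : Fin Z₂.len) (hk : g.sing i = k) (hl : h.sing k = l)
    (hil : (g ≫ h).sing i = l) :
    (g ≫ h).app i l hil = g.app i k hk ≫ h.app k l hl := by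
  subst hk
  rfl

/-- The singular monotone functor, sending a zigzag to its ordinal of singular heights. -/
def S (C : Type u) [Category.{v} C] : ZigzagIn C ⥤ Delta where
  obj Z := Z.singHeights
  map g := ⟨g.sing⟩

/-- The restricted zigzag: the part of `Z` from the regular object `r a` to the regular object
`r b`. -/
def restrict (Z : ZigzagIn C) (a b : Fin (Z.len + 1)) (hab : a ≤ b) : ZigzagIn C where
  len := b.val - a.val
  r x := Z.r ⟨a.val + x.val, by have : a.val ≤ b.val := hab; have := b.2; have := x.2; omega⟩
  s i := Z.s ⟨a.val + i.val, by have := b.2; have := i.2; omega⟩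
  f i := Z.f ⟨a.val + i.val, by have := b.2; have := i.2; omega⟩
  b i := Z.b ⟨a.val + i.val, by have := b.2; have := i.2; omega⟩

section restrict

variable {Z Z' : ZigzagIn C} (g : Z ⟶ Z') {a₀ b₀ : Fin (Z.len + 1)} {a b : Fin (Z'.len + 1)}
  (hab₀ : a₀ ≤ b₀) (hab : a ≤ b) (ha : Delta.rev g.sing a = a₀) (hb : Delta.rev g.sing b = b₀)

theorem restrict_bounds {Z Z' : ZigzagIn C} (g : Z ⟶ Z') {a₀ b₀ : Fin (Z.len + 1)}
    {a b : Fin (Z'.len + 1)} (ha : Delta.rev g.sing a = a₀) (hb : Delta.rev g.sing b = b₀)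
    (i : Fin Z.len) (h₁ : a₀.val ≤ i.val) (h₂ : i.val < b₀.val) :
    a.val ≤ (g.sing i).val ∧ (g.sing i).val < b.val :=
  ⟨(Delta.rev_le_castSucc g.sing a i).1 (ha ▸ h₁), (Delta.lt_rev g.sing b i).1 (hb ▸ h₂)⟩

/-- The monotone map on singular heights of a restricted zigzag map. -/
def restrictSing :
    Fin (Z.restrict a₀ b₀ hab₀).len →o Fin (Z'.restrict a b hab).len where
      toFun := fun i =>
        ⟨(g.sing ⟨a₀.val + i.val, by
            have := b₀.2; have : i.val < b₀.val - a₀.val := i.2; omega⟩).val - a.val, by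
          have h : i.val < b₀.val - a₀.val := i.2
          have := restrict_bounds g ha hb ⟨a₀.val + i.val, by have := b₀.2; omega⟩
            (by simp) (by simp; omega)
          change _ < b.val - a.val
          omega⟩
      monotone' := by
        intro i j hij
        have : i.val ≤ j.val := hij
        simp only [Fin.mk_le_mk]
        refine Nat.sub_le_sub_right ?_ _
        exact g.sing.monotone (by simpa using hij)

theorem restrict_sing_val (i : Fin (Z.restrict a₀ b₀ hab₀).len) (hi : a₀.val + i.val < Z.len) :
    a.val + (restrictSing g hab₀ hab ha hb i).val = (g.sing ⟨a₀.val + i.val, hi⟩).val := by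
  have h : i.val < b₀.val - a₀.val := i.2
  have := restrict_bounds g ha hb ⟨a₀.val + i.val, by have := b₀.2; omega⟩
    (by simp) (by simp; omega)
  change a.val + ((g.sing ⟨a₀.val + i.val, hi⟩).val - a.val) = _
  omega

theorem restrict_rev (x : Fin ((Z'.restrict a b hab).len + 1)) (hx : a.val + x.val < Z'.len + 1) :
    a₀.val + (Delta.rev (restrictSing g hab₀ hab ha hb) x).val =
      (Delta.rev g.sing ⟨a.val + x.val, hx⟩).val := by
  have hab' : a.val ≤ b.val := hab
  have hab₀' : a₀.val ≤ b₀.val := hab₀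
  have hx' : x.val < b.val - a.val + 1 := x.2
  have hr : (Delta.rev (restrictSing g hab₀ hab ha hb) x).val < b₀.val - a₀.val + 1 :=
    (Delta.rev (restrictSing g hab₀ hab ha hb) x).2
  have hb₀ := b₀.2
  have l1 : a₀.val ≤ (Delta.rev g.sing ⟨a.val + x.val, hx⟩).val := by
    rw [← ha]
    exact Delta.rev_mono g.sing (by simp [Fin.le_def])
  have l2 : (Delta.rev g.sing ⟨a.val + x.val, hx⟩).val ≤ b₀.val := by
    rw [← hb]
    exact Delta.rev_mono g.sing (by simp [Fin.le_def]; omega)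
  have key : ∀ i : ℕ, i < b₀.val - a₀.val →
      ((Delta.rev (restrictSing g hab₀ hab ha hb) x).val ≤ i ↔
        (Delta.rev g.sing ⟨a.val + x.val, hx⟩).val ≤ a₀.val + i) := by
    intro i hi
    have h1 := Delta.rev_le_castSucc (restrictSing g hab₀ hab ha hb) x ⟨i, hi⟩
    have h2 := Delta.rev_le_castSucc g.sing ⟨a.val + x.val, hx⟩ ⟨a₀.val + i, by omega⟩
    have h3 := restrict_sing_val g hab₀ hab ha hb ⟨i, hi⟩ (by simp; omega)
    simp only at h1 h2 h3
    rw [h1, h2]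
    omega
  by_contra hne
  rcases Nat.lt_or_gt_of_ne hne with hlt | hlt
  · have := (key _ (by omega)).1 le_rfl
    omega
  · have := (key ((Delta.rev g.sing ⟨a.val + x.val, hx⟩).val - a₀.val) (by omega)).2 (by omega)
    omega

theorem restrict_rev_eq (x : Fin ((Z'.restrict a b hab).len + 1))
    (x' : Fin (Z'.len + 1)) (hx : x'.val = a.val + x.val)
    (y : Fin ((Z.restrict a₀ b₀ hab₀).len + 1))
    (y' : Fin (Z.len + 1)) (hy : y'.val = a₀.val + y.val)
    (h : Delta.rev (restrictSing g hab₀ hab ha hb) x = y) : Delta.rev g.sing x' = y' := by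
  have := restrict_rev g hab₀ hab ha hb x (hx ▸ x'.2)
  have hxx : x' = ⟨a.val + x.val, hx ▸ x'.2⟩ := Fin.ext hx
  rw [hxx]
  apply Fin.ext
  rw [← this, h, hy]

theorem restrict_sing_eq (i : Fin (Z.restrict a₀ b₀ hab₀).len)
    (k : Fin (Z'.restrict a b hab).len)
    (h : restrictSing g hab₀ hab ha hb i = k)
    (hi : a₀.val + i.val < Z.len) (hk : a.val + k.val < Z'.len) :
    g.sing ⟨a₀.val + i.val, hi⟩ = ⟨a.val + k.val, hk⟩ := by
  apply Fin.ext
  rw [← restrict_sing_val g hab₀ hab ha hb i hi, h]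

/-- The restricted zigzag map `Z.restrict a₀ b₀ ⟶ Z'.restrict a b` of a zigzag map `g : Z ⟶ Z'`,
where `a ≤ b` are regular heights of `Z'` and `a₀`, `b₀` are their images in `Z`. -/
def restrictMap : Z.restrict a₀ b₀ hab₀ ⟶ Z'.restrict a b hab where
  sing := restrictSing g hab₀ hab ha hb
  app i k h := g.app _ _ (restrict_sing_eq g hab₀ hab ha hb i k h _ _)
  reg_eq x := (g.reg_eq _).trans
    (congrArg Z.r (restrict_rev_eq g hab₀ hab ha hb x _ rfl _ ⟨_, _⟩ rfl rfl))
  comm_empty k h := by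
    refine g.comm_empty ⟨a.val + k.val, by have := b.2; have : k.val < b.val - a.val := k.2; omega⟩
      ?_
    apply Fin.ext
    have h1 := restrict_rev g hab₀ hab ha hb k.castSucc
      (by have := b.2; have : k.val < b.val - a.val := k.2; simp; omega)
    have h2 := restrict_rev g hab₀ hab ha hb k.succ
      (by have := b.2; have : k.val < b.val - a.val := k.2; simp; omega)
    rw [h] at h1
    exact h1.symm.trans h2
  comm_first i k hik h :=
    g.comm_first _ _ (restrict_sing_eq g hab₀ hab ha hb i k hik _ _)
      (restrict_rev_eq g hab₀ hab ha hb k.castSucc _ rfl i.castSucc _ rfl h)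
  comm_last i k hik h :=
    g.comm_last _ _ (restrict_sing_eq g hab₀ hab ha hb i k hik _ _)
      (restrict_rev_eq g hab₀ hab ha hb k.succ _ rfl i.succ _ rfl h)
  comm_mid i j k hik hjk h :=
    g.comm_mid _ _ _ (restrict_sing_eq g hab₀ hab ha hb i k hik _ _)
      (restrict_sing_eq g hab₀ hab ha hb j k hjk _ _)
      (Fin.ext (congrArg (fun x => a₀.val + x) (congrArg Fin.val h)))

end restrict

theorem app_congr {Z Z' : ZigzagIn C} {g g' : Z ⟶ Z'} (e : g = g') (i : Fin Z.len)
    (k : Fin Z'.len) (h : g.sing i = k) (h' : g'.sing i = k) : g.app i k h = g'.app i k h' := by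
  subst e
  rfl

theorem f_comp_eq (Z : ZigzagIn C) {i i' : Fin Z.len} (e : i = i') {A : C} (q : Z.s i' ⟶ A)
    (t : Z.r i'.castSucc ⟶ A) (h : Z.f i' ≫ q = t) :
    Z.f i ≫ eqToHom (congrArg Z.s e) ≫ q =
      eqToHom (congrArg (fun i => Z.r i.castSucc) e) ≫ t := by
  subst e
  simpa using h

theorem b_comp_eq (Z : ZigzagIn C) {i i' : Fin Z.len} (e : i = i') {A : C} (q : Z.s i' ⟶ A)
    (t : Z.r i'.succ ⟶ A) (h : Z.b i' ≫ q = t) :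
    Z.b i ≫ eqToHom (congrArg Z.s e) ≫ q =
      eqToHom (congrArg (fun i => Z.r i.succ) e) ≫ t := by
  subst e
  simpa using h

theorem app_comp_eq {Z Z' : ZigzagIn C} (g : Z ⟶ Z') {i i' : Fin Z.len} {k k' : Fin Z'.len}
    (e : i = i') (e' : k = k') (h : g.sing i = k) (h' : g.sing i' = k') {A : C} (q : Z'.s k' ⟶ A)
    (t : Z.s i' ⟶ A) (hq : g.app i' k' h' ≫ q = t) :
    g.app i k h ≫ eqToHom (congrArg Z'.s e') ≫ q = eqToHom (congrArg Z.s e) ≫ t := by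
  subst e e'
  simpa using hq

variable {J : Type u₁} [Category.{v₁} J]

section restrict

theorem restrictMap_id {Z : ZigzagIn C} (g : Z ⟶ Z) (hg : g = 𝟙 Z) {a b : Fin (Z.len + 1)}
    (hab : a ≤ b) (ha : Delta.rev g.sing a = a) (hb : Delta.rev g.sing b = b) :
    restrictMap g hab hab ha hb = 𝟙 _ := by
  subst hg
  have hlt : ∀ i : Fin (Z.restrict a b hab).len, a.val + i.val < Z.len := fun i => by
    have := b.2
    have h : i.val < b.val - a.val := i.2
    omega
  have hs : ∀ i, (restrictMap (𝟙 Z) hab hab ha hb).sing i = i := fun i =>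
    Fin.ext (Nat.add_left_cancel (restrict_sing_val (𝟙 Z) hab hab ha hb i (hlt i)))
  refine hom_ext _ _ hs fun i k hk hk' => ?_
  rfl

theorem restrictMap_comp {Z Z₁ Z₂ : ZigzagIn C} (g : Z ⟶ Z₁) (h : Z₁ ⟶ Z₂) (gh : Z ⟶ Z₂)
    (e : gh = g ≫ h) {a₀ b₀ : Fin (Z.len + 1)} {a b : Fin (Z₁.len + 1)} {a' b' : Fin (Z₂.len + 1)}
    (hab₀ : a₀ ≤ b₀) (hab : a ≤ b) (hab' : a' ≤ b')
    (ha : Delta.rev g.sing a = a₀) (hb : Delta.rev g.sing b = b₀)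
    (ha' : Delta.rev h.sing a' = a) (hb' : Delta.rev h.sing b' = b)
    (ha'' : Delta.rev gh.sing a' = a₀) (hb'' : Delta.rev gh.sing b' = b₀) :
    restrictMap gh hab₀ hab' ha'' hb'' =
      restrictMap g hab₀ hab ha hb ≫ restrictMap h hab hab' ha' hb' := by
  subst e
  have hlt : ∀ i : Fin (Z.restrict a₀ b₀ hab₀).len, a₀.val + i.val < Z.len := fun i => by
    have := b₀.2
    have h : i.val < b₀.val - a₀.val := i.2
    omega
  have hlt₁ : ∀ i : Fin (Z₁.restrict a b hab).len, a.val + i.val < Z₁.len := fun i => by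
    have := b.2
    have h : i.val < b.val - a.val := i.2
    omega
  have hlt₂ : ∀ i : Fin (Z₂.restrict a' b' hab').len, a'.val + i.val < Z₂.len := fun i => by
    have := b'.2
    have h : i.val < b'.val - a'.val := i.2
    omega
  have hs : ∀ i, (restrictMap (g ≫ h) hab₀ hab' ha'' hb'').sing i =
      (restrictMap g hab₀ hab ha hb ≫ restrictMap h hab hab' ha' hb').sing i := fun i => by
    have h1 := restrict_sing_val (g ≫ h) hab₀ hab' ha'' hb'' i (hlt i)
    have h2 := restrict_sing_eq g hab₀ hab ha hb i _ rfl (hlt i) (hlt₁ _)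
    have h3 := restrict_sing_val h hab hab' ha' hb' (restrictSing g hab₀ hab ha hb i) (hlt₁ _)
    refine Fin.ext (Nat.add_left_cancel (h1.trans (Eq.trans ?_ h3.symm)))
    exact congrArg (fun x => (h.sing x).val) h2
  refine hom_ext _ _ hs fun i l hl hl' => ?_
  rw [comp_app _ _ i _ l rfl hl' hl']
  exact comp_app g h _ _ _ (restrict_sing_eq g hab₀ hab ha hb i _ rfl (hlt i) (hlt₁ _))
    (restrict_sing_eq h hab hab' ha' hb' _ l hl' (hlt₁ _) (hlt₂ l)) _

end restrict

section deconstruction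

/-- The vertices of the deconstruction of a diagram `K` of zigzags: an object `j` together with a
regular or a singular height of `K.obj j`. -/
inductive DeconObj (K : J ⥤ ZigzagIn C) : Type u₁
  | reg (j : J) (x : Fin ((K.obj j).len + 1)) : DeconObj K
  | sing (j : J) (i : Fin (K.obj j).len) : DeconObj K

/-- The generating arrows of the deconstruction: the forward and backward arrows of all the
zigzags, and for each `φ : j ⟶ j'` the arrows between singular heights and, in the opposite
direction, between regular heights. -/
inductive DeconHom (K : J ⥤ ZigzagIn C) : DeconObj K → DeconObj K → Type (max u₁ v₁)
  | fwd (j : J) (i : Fin (K.obj j).len) : DeconHom K (.reg j i.castSucc) (.sing j i)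
  | bwd (j : J) (i : Fin (K.obj j).len) : DeconHom K (.reg j i.succ) (.sing j i)
  | sing {j j' : J} (φ : j ⟶ j') (i : Fin (K.obj j).len) :
      DeconHom K (.sing j i) (.sing j' ((K.map φ).sing i))
  | reg {j j' : J} (φ : j ⟶ j') (x : Fin ((K.obj j').len + 1)) :
      DeconHom K (.reg j' x) (.reg j (Delta.rev (K.map φ).sing x))

instance (K : J ⥤ ZigzagIn C) : Quiver (DeconObj K) where
  Hom := DeconHom K

/-- The deconstruction, as a diagram shaped by the quiver of generating arrows: the arrows between
regular heights are sent to identities, along the equalities of regular objects. -/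
def deconPrefunctor (K : J ⥤ ZigzagIn C) : DeconObj K ⥤q C where
  obj
    | .reg j x => (K.obj j).r x
    | .sing j i => (K.obj j).s i
  map
    | .fwd j i => (K.obj j).f i
    | .bwd j i => (K.obj j).b i
    | .sing φ i => (K.map φ).app i _ rfl
    | .reg φ x => eqToHom ((K.map φ).reg_eq x)

/-- The deconstruction of a diagram `K` of zigzags in `C`: a diagram in `C`, the union of the
diagrams of all the zigzag maps `K.map φ`. Its shape is the category generated by the arrows
above. -/
def deconstruction (K : J ⥤ ZigzagIn C) : Paths (DeconObj K) ⥤ C :=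
  Paths.lift (deconPrefunctor K)

variable {K : J ⥤ ZigzagIn C} (p : Cocone (deconstruction K))

/-- The leg of a cocone under the deconstruction at a regular height. -/
def regLeg (j : J) (x : Fin ((K.obj j).len + 1)) : (K.obj j).r x ⟶ p.pt :=
  p.ι.app ((Paths.of _).obj (DeconObj.reg j x))

/-- The leg of a cocone under the deconstruction at a singular height. -/
def singLeg (j : J) (i : Fin (K.obj j).len) : (K.obj j).s i ⟶ p.pt :=
  p.ι.app ((Paths.of _).obj (DeconObj.sing j i))

theorem leg_w {a b : DeconObj K} (e : a ⟶ b) :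
    (deconPrefunctor K).map e ≫ p.ι.app ((Paths.of _).obj b) =
      p.ι.app ((Paths.of _).obj a) := by
  have h := p.w ((Paths.of _).map e)
  have h' : (deconstruction K).map ((Paths.of _).map e) = (deconPrefunctor K).map e :=
    Paths.lift_toPath (deconPrefunctor K) e
  rw [h'] at h
  exact h

theorem f_singLeg (j : J) (i : Fin (K.obj j).len) :
    (K.obj j).f i ≫ singLeg p j i = regLeg p j i.castSucc := leg_w p (DeconHom.fwd j i)

theorem b_singLeg (j : J) (i : Fin (K.obj j).len) :
    (K.obj j).b i ≫ singLeg p j i = regLeg p j i.succ := leg_w p (DeconHom.bwd j i)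

theorem app_singLeg {j j' : J} (φ : j ⟶ j') (i : Fin (K.obj j).len) (k : Fin (K.obj j').len)
    (h : (K.map φ).sing i = k) : (K.map φ).app i k h ≫ singLeg p j' k = singLeg p j i := by
  subst h
  exact leg_w p (DeconHom.sing φ i)

theorem eqToHom_regLeg {j j' : J} (φ : j ⟶ j') (x : Fin ((K.obj j').len + 1))
    (y : Fin ((K.obj j).len + 1)) (h : Delta.rev (K.map φ).sing x = y) :
    eqToHom (((K.map φ).reg_eq x).trans (congrArg (K.obj j).r h)) ≫ regLeg p j y =
      regLeg p j' x := by
  subst h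
  exact leg_w p (DeconHom.reg φ x)

theorem regLeg_congr (j : J) {x y : Fin ((K.obj j).len + 1)} (h : x = y) :
    regLeg p j x = eqToHom (congrArg (K.obj j).r h) ≫ regLeg p j y := by
  subst h
  simp

end deconstruction

section restrictedDiagram

variable {D : J ⥤ ZigzagIn C} (c : Cocone (D ⋙ S C))

/-- The monotone map `D(j)_sing → c` that is the leg at `j` of a cocone under the diagram of
singular heights. -/
def leg (j : J) : Fin (D.obj j).len →o Fin c.pt.len := Delta.Hom.map (c.ι.app j)

theorem leg_comp {j j' : J} (φ : j ⟶ j') : (leg c j').comp (D.map φ).sing = leg c j :=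
  congrArg Delta.Hom.map (c.w φ)

theorem rev_leg {j j' : J} (φ : j ⟶ j') (x : Fin (c.pt.len + 1)) :
    Delta.rev (D.map φ).sing (Delta.rev (leg c j') x) = Delta.rev (leg c j) x := by
  rw [← leg_comp c φ, Delta.rev_comp]

/-- The diagram `D` restricted to the height `k` of `c`: on objects, `D(j)` is restricted to the
part between the regular heights that the reversal of the leg at `j` assigns to `k` and
`k + 1`. -/
def restrictedDiagram (k : Fin c.pt.len) : J ⥤ ZigzagIn C where
  obj j := (D.obj j).restrict (Delta.rev (leg c j) k.castSucc) (Delta.rev (leg c j) k.succ)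
    (Delta.rev_mono _ Fin.castSucc_lt_succ.le)
  map φ := restrictMap (D.map φ) _ _ (rev_leg c φ _) (rev_leg c φ _)
  map_id j := restrictMap_id _ (D.map_id j) _ _ _
  map_comp φ ψ := restrictMap_comp _ _ _ (D.map_comp φ ψ) _ _ _ _ _ _ _ _ _

end restrictedDiagram

/-- The procedure succeeds on the diagram `D`: the diagram of singular heights has a colimit in
`Delta`, and, for a colimit cocone `c` of it (whichever is chosen) and for every height `k` of `c`,
the deconstruction of `D` restricted to the height `k` has a colimit in `C`. -/
def ProcedureSucceeds (D : J ⥤ ZigzagIn C) : Prop :=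
  HasColimit (D ⋙ S C) ∧
    ∀ (c : Cocone (D ⋙ S C)) (_ : IsColimit c) (k : Fin c.pt.len),
      HasColimit (deconstruction (restrictedDiagram c k))

/-- A successful run of the procedure on the diagram `D`, recording all the choices made: the
colimit `c` of the diagram of singular heights; for every height `k` of `c` a colimit `p k` of the
deconstruction of the restricted diagram; for every height `k` an object `j k` at which the
restricted zigzag has a singular height; and an object `j₀` from which the regular objects are
read off (by connectedness, any two objects give the same regular objects). -/
structure ProcedureRun (D : J ⥤ ZigzagIn C) where
  /-- the colimit of the diagram of singular heights -/
  c : Cocone (D ⋙ S C)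
  /-- `c` is a colimit -/
  hc : IsColimit c
  /-- the colimit at height `k` -/
  p : ∀ k : Fin c.pt.len, Cocone (deconstruction (restrictedDiagram c k))
  /-- `p k` is a colimit -/
  hp : ∀ k, IsColimit (p k)
  /-- the object chosen at height `k` -/
  j : Fin c.pt.len → J
  hj : ∀ k, 0 < ((restrictedDiagram c k).obj (j k)).len
  /-- the object from which the regular objects are read off -/
  j₀ : J

namespace ProcedureRun

section

variable {D : J ⥤ ZigzagIn C} (c : Cocone (D ⋙ S C))

theorem r_eq [IsConnected J] (j j' : J) (x : Fin (c.pt.len + 1)) :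
    (D.obj j).r (Delta.rev (leg c j) x) = (D.obj j').r (Delta.rev (leg c j') x) :=
  constant_of_preserves_morphisms (fun j => (D.obj j).r (Delta.rev (leg c j) x))
    (fun j₁ j₂ φ => by rw [(D.map φ).reg_eq, rev_leg c φ]) j j'

variable {c} {k : Fin c.pt.len} (p : Cocone (deconstruction (restrictedDiagram c k)))

theorem first_eq (j : J) :
    ((restrictedDiagram c k).obj j).r 0 = (D.obj j).r (Delta.rev (leg c j) k.castSucc) := rfl

theorem last_eq (j : J) : ((restrictedDiagram c k).obj j).r (Fin.last _) =
    (D.obj j).r (Delta.rev (leg c j) k.succ) :=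
  congrArg (D.obj j).r (Fin.ext (Nat.add_sub_cancel'
    (Delta.rev_mono (leg c j) (Fin.castSucc_lt_succ (i := k)).le)))

theorem regLeg_first [IsConnected J] (j j' : J) :
    regLeg p j 0 = eqToHom ((first_eq j).trans ((r_eq c j j' _).trans (first_eq j').symm)) ≫
      regLeg p j' 0 := by
  have h := constant_of_preserves_morphisms
    (fun i => eqToHom ((first_eq j).trans ((r_eq c j i _).trans (first_eq i).symm)) ≫ regLeg p i 0)
    (fun j₁ j₂ φ => by
      rw [← eqToHom_regLeg p φ 0 0 (Fin.ext ?_)]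
      · simp
      · have := restrict_rev (D.map φ) (Delta.rev_mono _ Fin.castSucc_lt_succ.le)
          (Delta.rev_mono _ Fin.castSucc_lt_succ.le) (rev_leg c φ k.castSucc)
          (rev_leg c φ k.succ) 0 (Delta.rev (leg c j₂) k.castSucc).2
        have h2 := congrArg Fin.val (rev_leg c φ k.castSucc)
        exact Nat.add_left_cancel (this.trans h2)) j j'
  simpa using h

theorem regLeg_last [IsConnected J] (j j' : J) :
    regLeg p j (Fin.last _) =
      eqToHom ((last_eq j).trans ((r_eq c j j' _).trans (last_eq j').symm)) ≫
        regLeg p j' (Fin.last _) := by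
  have h := constant_of_preserves_morphisms
    (fun i => eqToHom ((last_eq j).trans ((r_eq c j i _).trans (last_eq i).symm)) ≫
      regLeg p i (Fin.last _))
    (fun j₁ j₂ φ => by
      rw [← eqToHom_regLeg p φ (Fin.last _) (Fin.last _) (Fin.ext ?_)]
      · simp
      · have l1 : ∀ j, (Delta.rev (leg c j) k.castSucc).val + (Fin.last
            ((restrictedDiagram c k).obj j).len).val = (Delta.rev (leg c j) k.succ).val := fun j =>
          Nat.add_sub_cancel' (Delta.rev_mono (leg c j) (Fin.castSucc_lt_succ (i := k)).le)
        have := restrict_rev (D.map φ) (Delta.rev_mono _ Fin.castSucc_lt_succ.le)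
          (Delta.rev_mono _ Fin.castSucc_lt_succ.le) (rev_leg c φ k.castSucc)
          (rev_leg c φ k.succ) (Fin.last _)
          (lt_of_eq_of_lt (l1 j₂) (Delta.rev (leg c j₂) k.succ).2)
        refine Nat.add_left_cancel (this.trans (Eq.trans ?_ (l1 j₁).symm))
        rw [← rev_leg c φ k.succ]
        exact congrArg (fun x => (Delta.rev (D.map φ).sing x).val) (Fin.ext (l1 j₂))) j j'
  simpa using h

end

variable {D : J ⥤ ZigzagIn C} (R : ProcedureRun D)

/-- The forward map of the length-one zigzag at height `k`: the first forward map of the restricted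
zigzag at the chosen object, followed by the leg of the colimit. -/
def fwd (k : Fin R.c.pt.len) :
    (D.obj (R.j k)).r (Delta.rev (leg R.c (R.j k)) k.castSucc) ⟶ (R.p k).pt :=
  ((restrictedDiagram R.c k).obj (R.j k)).f ⟨0, R.hj k⟩ ≫ singLeg (R.p k) (R.j k) ⟨0, R.hj k⟩

theorem last_eq_succ {n : ℕ} (h : 0 < n) :
    Fin.last n = Fin.succ ⟨n - 1, Nat.sub_one_lt_of_lt h⟩ :=
  Fin.ext (Nat.sub_add_cancel h).symm

/-- The backward map of the length-one zigzag at height `k`: the last backward map of the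
restricted zigzag at the chosen object, followed by the leg of the colimit. -/
def bwd (k : Fin R.c.pt.len) :
    (D.obj (R.j k)).r (Delta.rev (leg R.c (R.j k)) k.succ) ⟶ (R.p k).pt :=
  eqToHom ((last_eq (R.j k)).symm.trans
      (congrArg ((restrictedDiagram R.c k).obj (R.j k)).r (last_eq_succ (R.hj k)))) ≫
    ((restrictedDiagram R.c k).obj (R.j k)).b
        ⟨((restrictedDiagram R.c k).obj (R.j k)).len - 1, Nat.sub_one_lt_of_lt (R.hj k)⟩ ≫
      singLeg (R.p k) (R.j k)
        ⟨((restrictedDiagram R.c k).obj (R.j k)).len - 1, Nat.sub_one_lt_of_lt (R.hj k)⟩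

theorem sub_lt (j : J) (i : Fin (D.obj j).len) (k : Fin R.c.pt.len) (h : leg R.c j i = k) :
    i.val - (Delta.rev (leg R.c j) k.castSucc).val < ((restrictedDiagram R.c k).obj j).len := by
  have h1 := (Delta.rev_le_castSucc (leg R.c j) k.castSucc i).2 (by simp [h])
  have h2 := (Delta.lt_rev (leg R.c j) k.succ i).2 (by simp [h])
  change _ < (Delta.rev (leg R.c j) k.succ).val - (Delta.rev (leg R.c j) k.castSucc).val
  omega

theorem add_sub_eq (j : J) (i : Fin (D.obj j).len) (k : Fin R.c.pt.len) (h : leg R.c j i = k) :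
    (Delta.rev (leg R.c j) k.castSucc).val +
      (i.val - (Delta.rev (leg R.c j) k.castSucc).val) = i.val := by
  have h1 := (Delta.rev_le_castSucc (leg R.c j) k.castSucc i).2 (by simp [h])
  omega

/-- The morphism from the singular object at height `i` of `D(j)` to the singular object at height
`k`, the image of `i`, of the constructed zigzag: the leg of the colimit `p k`. -/
def legApp (j : J) (i : Fin (D.obj j).len) (k : Fin R.c.pt.len) (h : leg R.c j i = k) :
    (D.obj j).s i ⟶ (R.p k).pt :=
  eqToHom (congrArg (D.obj j).s (Fin.ext (R.add_sub_eq j i k h).symm)) ≫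
    singLeg (R.p k) j ⟨i.val - (Delta.rev (leg R.c j) k.castSucc).val, R.sub_lt j i k h⟩

theorem f_legApp (j : J) (i : Fin (D.obj j).len) (k : Fin R.c.pt.len) (h : leg R.c j i = k)
    (x : Fin (((restrictedDiagram R.c k).obj j).len + 1))
    (hx : (Delta.rev (leg R.c j) k.castSucc).val + x.val = i.val) :
    (D.obj j).f i ≫ R.legApp j i k h =
      eqToHom (congrArg (D.obj j).r (Fin.ext hx.symm)) ≫ regLeg (R.p k) j x := by
  have e : x = Fin.castSucc ⟨i.val - (Delta.rev (leg R.c j) k.castSucc).val, R.sub_lt j i k h⟩ :=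
    Fin.ext (by simp; omega)
  obtain rfl := e
  exact f_comp_eq (D.obj j) (Fin.ext (R.add_sub_eq j i k h).symm) _ _ (f_singLeg (R.p k) j _)

theorem b_legApp (j : J) (i : Fin (D.obj j).len) (k : Fin R.c.pt.len) (h : leg R.c j i = k)
    (x : Fin (((restrictedDiagram R.c k).obj j).len + 1))
    (hx : (Delta.rev (leg R.c j) k.castSucc).val + x.val = i.val + 1) :
    (D.obj j).b i ≫ R.legApp j i k h =
      eqToHom (congrArg (D.obj j).r (Fin.ext hx.symm)) ≫ regLeg (R.p k) j x := by
  have h1 := R.add_sub_eq j i k h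
  have e : x = Fin.succ ⟨i.val - (Delta.rev (leg R.c j) k.castSucc).val, R.sub_lt j i k h⟩ :=
    Fin.ext (by simp; omega)
  obtain rfl := e
  exact b_comp_eq (D.obj j) (Fin.ext (R.add_sub_eq j i k h).symm) _ _ (b_singLeg (R.p k) j _)

theorem leg_comm_mid (j : J) (i i' : Fin (D.obj j).len) (k : Fin R.c.pt.len)
    (hik : leg R.c j i = k) (hik' : leg R.c j i' = k) (h : i.succ = i'.castSucc) :
    (D.obj j).b i ≫ R.legApp j i k hik =
      eqToHom (congrArg (D.obj j).r h) ≫ (D.obj j).f i' ≫ R.legApp j i' k hik' := by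
  have hv : i.val + 1 = i'.val := congrArg Fin.val h
  have h2 := R.add_sub_eq j i' k hik'
  rw [R.f_legApp j i' k hik' (Fin.castSucc ⟨_, R.sub_lt j i' k hik'⟩) h2,
    R.b_legApp j i k hik (Fin.castSucc ⟨_, R.sub_lt j i' k hik'⟩) (h2.trans hv.symm)]
  exact (eqToHom_trans_assoc _ _ _).symm

variable [IsConnected J]

/-- The zigzag constructed by the procedure: the concatenation, over the heights `k` of `c`, of the
length-one zigzags with singular object `(p k).pt` and with the maps `fwd k` and `bwd k`. Its
regular objects are those common to all the zigzags `D(j)`, at the heights that the reversal of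
`leg c j` assigns to the heights of `c`; `eqToHom` only identifies equal regular objects. -/
def zigzag : ZigzagIn C where
  len := R.c.pt.len
  r x := (D.obj R.j₀).r (Delta.rev (leg R.c R.j₀) x)
  s k := (R.p k).pt
  f k := eqToHom (r_eq R.c R.j₀ (R.j k) _) ≫ R.fwd k
  b k := eqToHom (r_eq R.c R.j₀ (R.j k) _) ≫ R.bwd k

theorem zigzag_f (k : Fin R.c.pt.len) (j : J) :
    R.zigzag.f k =
      eqToHom ((r_eq R.c R.j₀ j _).trans (first_eq j).symm) ≫ regLeg (R.p k) j 0 := by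
  have h : R.fwd k = regLeg (R.p k) (R.j k) 0 := f_singLeg (R.p k) (R.j k) ⟨0, R.hj k⟩
  change eqToHom _ ≫ R.fwd k = _
  rw [h, regLeg_first (R.p k) (R.j k) j]
  exact eqToHom_trans_assoc _ _ _

theorem zigzag_b (k : Fin R.c.pt.len) (j : J) :
    R.zigzag.b k =
      eqToHom ((r_eq R.c R.j₀ j _).trans (last_eq j).symm) ≫ regLeg (R.p k) j (Fin.last _) := by
  have h : R.bwd k = eqToHom (last_eq (R.j k)).symm ≫ regLeg (R.p k) (R.j k) (Fin.last _) := by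
    have e := last_eq_succ (R.hj k)
    rw [regLeg_congr (R.p k) _ e, bwd, b_singLeg]
    simp
  change eqToHom _ ≫ R.bwd k = _
  rw [h, regLeg_last (R.p k) (R.j k) j]
  simp

theorem leg_comm_empty (j : J) (k : Fin R.c.pt.len)
    (h : Delta.rev (leg R.c j) k.castSucc = Delta.rev (leg R.c j) k.succ) :
    R.zigzag.f k = eqToHom ((r_eq R.c R.j₀ j _).trans
      ((congrArg (D.obj j).r h).trans (r_eq R.c R.j₀ j _).symm)) ≫ R.zigzag.b k := by
  have e : (0 : Fin (((restrictedDiagram R.c k).obj j).len + 1)) = Fin.last _ := by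
    have hv : (Delta.rev (leg R.c j) k.castSucc).val = (Delta.rev (leg R.c j) k.succ).val :=
      congrArg Fin.val h
    apply Fin.ext
    exact (Nat.sub_eq_zero_of_le hv.ge).symm
  rw [R.zigzag_f k j, R.zigzag_b k j, regLeg_congr (R.p k) j e]
  exact (eqToHom_trans_assoc _ _ _).trans (eqToHom_trans_assoc _ _ _).symm

theorem leg_comm_first (j : J) (i : Fin (D.obj j).len) (k : Fin R.c.pt.len)
    (hik : leg R.c j i = k) (h : Delta.rev (leg R.c j) k.castSucc = i.castSucc) :
    R.zigzag.f k = eqToHom ((r_eq R.c R.j₀ j _).trans (congrArg (D.obj j).r h)) ≫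
      (D.obj j).f i ≫ R.legApp j i k hik := by
  rw [R.f_legApp j i k hik 0 (congrArg Fin.val h), R.zigzag_f k j]
  exact (eqToHom_trans_assoc _ _ _).symm

theorem leg_comm_last (j : J) (i : Fin (D.obj j).len) (k : Fin R.c.pt.len)
    (hik : leg R.c j i = k) (h : Delta.rev (leg R.c j) k.succ = i.succ) :
    R.zigzag.b k = eqToHom ((r_eq R.c R.j₀ j _).trans (congrArg (D.obj j).r h)) ≫
      (D.obj j).b i ≫ R.legApp j i k hik := by
  have e : (Delta.rev (leg R.c j) k.castSucc).val +
      (Fin.last ((restrictedDiagram R.c k).obj j).len).val = i.val + 1 :=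
    (Nat.add_sub_cancel' (Delta.rev_mono (leg R.c j) (Fin.castSucc_lt_succ (i := k)).le)).trans
      (congrArg Fin.val h)
  rw [R.b_legApp j i k hik (Fin.last _) e, R.zigzag_b k j]
  exact (eqToHom_trans_assoc _ _ _).symm

/-- The zigzag map from `D(j)` to the constructed zigzag. -/
def zigzagLeg (j : J) : D.obj j ⟶ R.zigzag where
  sing := leg R.c j
  app := R.legApp j
  reg_eq := r_eq R.c R.j₀ j
  comm_empty := R.leg_comm_empty j
  comm_first := R.leg_comm_first j
  comm_last := R.leg_comm_last j
  comm_mid := R.leg_comm_mid j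

theorem map_zigzagLeg {j j' : J} (φ : j ⟶ j') : D.map φ ≫ R.zigzagLeg j' = R.zigzagLeg j := by
  refine hom_ext _ _ (fun i => congrArg (fun g => g i) (leg_comp R.c φ)) fun i k hk hk' => ?_
  have hk1 : leg R.c j' ((D.map φ).sing i) = k := hk
  have hk2 : leg R.c j i = k := hk'
  refine (comp_app (D.map φ) (R.zigzagLeg j') i _ k rfl hk1 hk).trans ?_
  change _ ≫ R.legApp j' _ k hk1 = R.legApp j i k hk2
  have e1 := R.add_sub_eq j i k hk2
  have e2 := R.add_sub_eq j' _ k hk1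
  have e3 := restrict_sing_val (D.map φ) (Delta.rev_mono _ Fin.castSucc_lt_succ.le)
    (Delta.rev_mono _ Fin.castSucc_lt_succ.le) (rev_leg R.c φ k.castSucc)
    (rev_leg R.c φ k.succ) ⟨_, R.sub_lt j i k hk2⟩ (lt_of_eq_of_lt e1 i.2)
  have e4 : (D.map φ).sing ⟨_, lt_of_eq_of_lt e1 i.2⟩ = (D.map φ).sing i :=
    congrArg _ (Fin.ext e1)
  have e5 : ((restrictedDiagram R.c k).map φ).sing ⟨_, R.sub_lt j i k hk2⟩ =
      ⟨_, R.sub_lt j' _ k hk1⟩ :=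
    Fin.ext (Nat.add_left_cancel ((e3.trans (congrArg Fin.val e4)).trans e2.symm))
  exact app_comp_eq (D.map φ) (Fin.ext e1.symm) (Fin.ext e2.symm) rfl _ _ _
    (app_singLeg (R.p k) φ ⟨_, R.sub_lt j i k hk2⟩ ⟨_, R.sub_lt j' _ k hk1⟩ e5)

/-- The cocone constructed by the procedure. -/
def cocone : Cocone D where
  pt := R.zigzag
  ι :=
    { app := R.zigzagLeg
      naturality := fun _ _ φ => (R.map_zigzagLeg φ).trans (Category.comp_id _).symm }

end ProcedureRun

end ZigzagIn

/-!
The proof reads a zigzag map `g : Z ⟶ W` through its *diagonals*. Over a singular height `k` of `W`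
lies an interval of regular heights `x` of `Z` (`Delta.RegOver`), and since the planar diagram of
`g` commutes, all its paths from `Z.r x` to `W.s k` have the same value `diag g x k`, also where no
singular height of `Z` is sent to `k`. The diagonals at the ends of the interval are the forward and
backward maps of `W` (`diag_eq_f`, `diag_eq_b`), and they are compatible with composition on both
sides (`diag_comp_rev`, `diag_comp_app`). So a zigzag map out of `W` can be constructed from
components that are only checked on the diagonals of one zigzag map into `W` (`factor`).

A cocone under `(D_k)^*` consists of legs at the singular and at the regular heights of the `D(j)`
over `k` (`legSing`, `legReg`, `mkCocone`). A cocone under `D` whose singular heights factor through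
`c` thus induces a cocone under each `(D_k)^*`, with the diagonals as legs at the regular heights
(`diagCocone`). Conversely, cocones under all the `(D_k)^*` glue to a cocone under `D`, with
singular heights `c` (`glueCocone`); connectedness makes the regular objects, and the legs at the
ends of each height, independent of the object of `J`.

The cocone that the procedure constructs is a colimit: given another cocone, the universal property
of `c` provides the map on singular heights, and the universal properties of the `p k`, applied to
the induced cocones, provide the components (`ProcedureRun.nonempty_isColimit_cocone`). A suitable
object can be chosen at each height because the legs of a colimit in `Delta` are jointly surjective
(`exists_leg_eq`).

For the converse, let `K` be a colimit of `D`. Gluing cocones with terminal vertices lifts every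
cocone under the diagram of singular heights to one under `D`, and by `sing_hom_ext` the
factorization through `K` is unique on singular heights already, so the singular heights of `K`
form a colimit (`nonempty_isColimit_mapCocone`). Gluing an arbitrary cocone under `(D_k)^*` at the
one height `k` with terminal ones elsewhere turns the universal property of `K` into the one of its
singular object over `k` (`hasColimit_deconstruction`).
-/

/-! ### Regular heights over a singular height -/

namespace Delta

variable {n m l : ℕ}

/-- The regular height `x` lies over the singular height `k` along the monotone map `σ`: it is one
of the regular heights of the part of the source that `σ` sends to `k`, both ends included. When no
singular height is sent to `k`, there is exactly one such `x`. -/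
def RegOver (σ : Fin n →o Fin m) (k : Fin m) (x : Fin (n + 1)) : Prop :=
  rev σ k.castSucc ≤ x ∧ x ≤ rev σ k.succ

variable (σ : Fin n →o Fin m) (τ : Fin m →o Fin l)

theorem rev_castSucc_le_rev_succ (k : Fin m) : rev σ k.castSucc ≤ rev σ k.succ :=
  rev_mono σ Fin.castSucc_lt_succ.le

theorem regOver_rev_castSucc (k : Fin m) : RegOver σ k (rev σ k.castSucc) :=
  ⟨le_rfl, rev_castSucc_le_rev_succ σ k⟩

theorem regOver_rev_succ (k : Fin m) : RegOver σ k (rev σ k.succ) :=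
  ⟨rev_castSucc_le_rev_succ σ k, le_rfl⟩

variable {σ τ} {k : Fin m} {x : Fin (n + 1)} {i : Fin n}

theorem regOver_castSucc (h : σ i = k) : RegOver σ k i.castSucc := by
  subst h
  constructor
  · exact (rev_le_castSucc σ _ i).2 (by simp)
  · exact ((lt_rev σ (σ i).succ i).2 (by simp)).le

theorem regOver_succ (h : σ i = k) : RegOver σ k i.succ := by
  subst h
  constructor
  · have h : (rev σ (σ i).castSucc).val ≤ i.val := (rev_le_castSucc σ _ i).2 (by simp)
    simp only [Fin.le_def, Fin.val_succ]
    omega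
  · exact (lt_rev σ (σ i).succ i).2 (by simp)

theorem RegOver.apply_eq (hx : RegOver σ k i.castSucc) (h : i.castSucc < rev σ k.succ) :
    σ i = k := by
  have h1 : k.val ≤ (σ i).val := (rev_le_castSucc σ k.castSucc i).1 hx.1
  have h2 : (σ i).val < k.val + 1 := (lt_rev σ k.succ i).1 h
  exact Fin.ext (by omega)

/-- A regular height over `k` is the last one, or the height just before a singular height in the
fibre over `k`. -/
theorem RegOver.eq_or (hx : RegOver σ k x) :
    x = rev σ k.succ ∨ ∃ i : Fin n, x = i.castSucc ∧ σ i = k := by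
  rcases hx.2.eq_or_lt with h | h
  · exact Or.inl h
  · have hl : x.val < (rev σ k.succ).val := h
    obtain ⟨i, rfl⟩ : ∃ i : Fin n, x = i.castSucc :=
      ⟨⟨x.val, by have := (rev σ k.succ).2; omega⟩, rfl⟩
    exact Or.inr ⟨i, rfl, hx.apply_eq h⟩

/-- The fibre of `σ` over `k` either is empty or begins with a singular height. -/
theorem rev_castSucc_eq_or (σ : Fin n →o Fin m) (k : Fin m) :
    rev σ k.castSucc = rev σ k.succ ∨ ∃ i : Fin n, rev σ k.castSucc = i.castSucc ∧ σ i = k :=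
  (regOver_rev_castSucc σ k).eq_or


theorem RegOver.comp_rev {k : Fin l} {x : Fin (m + 1)} (σ : Fin n →o Fin m)
    (hx : RegOver τ k x) : RegOver (τ.comp σ) k (rev σ x) := by
  constructor <;> rw [rev_comp]
  exacts [rev_mono σ hx.1, rev_mono σ hx.2]

/-- The fibre of `σ` over `k` is part of the fibre of the composite over the image of `k`. -/
theorem RegOver.comp {k' : Fin l} (hx : RegOver σ k x) (hk : τ k = k') :
    RegOver (τ.comp σ) k' x := by
  constructor <;> rw [rev_comp]
  · exact (rev_mono σ (regOver_castSucc hk).1).trans hx.1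
  · exact hx.2.trans (rev_mono σ (regOver_succ hk).2)

end Delta

/-! ### Diagonals of zigzag maps -/

namespace ZigzagIn

variable {C : Type u} [Category.{v} C]

section diag

variable {Z W Y : ZigzagIn C}

/-- The diagonal of the planar diagram of a zigzag map `g : Z ⟶ W`: the common value of all paths
from the regular object of `Z` at `x` to the singular object of `W` at `k`, for `x` over `k`. It
is defined by the path through the singular height of `Z` just after `x` where this height is in
the fibre over `k`, and by the path through the backward map of `W` otherwise. -/
def diag (g : Z ⟶ W) (x : Fin (Z.len + 1)) (k : Fin W.len) (hx : Delta.RegOver g.sing k x) :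
    Z.r x ⟶ W.s k :=
  if h : x < Delta.rev g.sing k.succ then
    Z.f ⟨x.val, by have := (Delta.rev g.sing k.succ).2; have : x.val < _ := h; omega⟩ ≫
      g.app ⟨x.val, _⟩ k (hx.apply_eq h)
  else eqToHom ((congrArg Z.r (le_antisymm hx.2 (not_lt.1 h))).trans (g.reg_eq _).symm) ≫ W.b k

variable (g : Z ⟶ W) (h : W ⟶ Y)

theorem diag_congr {x y : Fin (Z.len + 1)} (k : Fin W.len) (e : x = y) (hx hy) :
    diag g x k hx = eqToHom (congrArg Z.r e) ≫ diag g y k hy := by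
  subst e
  simp

theorem diag_congr_map {g g' : Z ⟶ W} (e : g = g') (x : Fin (Z.len + 1)) (k : Fin W.len)
    (hx hx') : diag g x k hx = diag g' x k hx' := by
  subst e
  rfl

theorem diag_castSucc (i : Fin Z.len) (k : Fin W.len) (hi : g.sing i = k) (hx) :
    diag g i.castSucc k hx = Z.f i ≫ g.app i k hi :=
  dif_pos (Fin.lt_def.2 ((Delta.lt_rev g.sing k.succ i).2 (by simp [hi])))

theorem diag_eq_b {x : Fin (Z.len + 1)} {k : Fin W.len} (e : x = Delta.rev g.sing k.succ) (hx) :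
    diag g x k hx = eqToHom ((congrArg Z.r e).trans (g.reg_eq _).symm) ≫ W.b k := by
  subst e
  exact dif_neg (lt_irrefl _)

theorem diag_succ (i : Fin Z.len) (k : Fin W.len) (hi : g.sing i = k) (hx) :
    diag g i.succ k hx = Z.b i ≫ g.app i k hi := by
  rcases hx.eq_or with h | ⟨j, h, hj⟩
  · rw [diag_eq_b g h, g.comm_last i k hi h.symm]
    simp
  · rw [diag_congr _ k h hx (Delta.regOver_castSucc hj), diag_castSucc g j k hj,
      g.comm_mid i j k hi hj h]

theorem diag_eq_f {x : Fin (Z.len + 1)} {k : Fin W.len} (e : x = Delta.rev g.sing k.castSucc)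
    (hx) : diag g x k hx = eqToHom ((congrArg Z.r e).trans (g.reg_eq _).symm) ≫ W.f k := by
  subst e
  rcases Delta.rev_castSucc_eq_or g.sing k with h | ⟨i, h, hi⟩
  · rw [diag_eq_b g h, g.comm_empty k h]
    simp
  · rw [diag_congr _ k h hx (Delta.regOver_castSucc hi), diag_castSucc g i k hi,
      g.comm_first i k hi h]
    simp

/-- Composition of zigzag maps as a vertical pasting of planar diagrams: the diagonal of `h` at `x`
is that of the composite at the height that `g` assigns to `x`. -/
theorem diag_comp_rev (x : Fin (W.len + 1)) (k : Fin Y.len) (hx) (hx') :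
    eqToHom (g.reg_eq x) ≫ diag (g ≫ h) (Delta.rev g.sing x) k hx' = diag h x k hx := by
  have base : ∀ (x : Fin (W.len + 1)) (hx) (hx'), x = Delta.rev h.sing k.succ →
      eqToHom (g.reg_eq x) ≫ diag (g ≫ h) (Delta.rev g.sing x) k hx' = diag h x k hx := by
    rintro x hx hx' rfl
    rw [diag_eq_b h rfl, diag_eq_b (g ≫ h) (Delta.rev_comp g.sing h.sing k.succ).symm]
    simp
  -- Where the fibre of `g` over the next singular height is empty, the forward and the backward map
  -- at that height agree, which reduces the height `x` to `x + 1`.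
  induction x using Fin.reverseInduction with
  | last =>
    rcases hx.eq_or with e | ⟨i, e, -⟩
    · exact base _ _ _ e
    · exact absurd e (Fin.castSucc_lt_last i).ne'
  | cast i ih =>
    rcases hx.eq_or with e | ⟨i', e, hi⟩
    · exact base _ _ _ e
    obtain rfl : i = i' := Fin.castSucc_injective _ e
    rw [diag_castSucc h i k hi]
    rcases Delta.rev_castSucc_eq_or g.sing i with e | ⟨j, e, hj⟩
    · have ih := ih (Delta.regOver_succ hi) ((Delta.regOver_succ hi).comp_rev g.sing)
      rw [diag_succ h i k hi] at ih
      rw [g.comm_empty i e, Category.assoc, ← ih, diag_congr _ k e hx'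
        ((Delta.regOver_succ hi).comp_rev g.sing)]
      simp
    · have hjk : (g ≫ h).sing j = k := (congrArg h.sing hj).trans hi
      rw [diag_congr _ k e hx' (Delta.regOver_castSucc hjk), diag_castSucc (g ≫ h) j k hjk,
        comp_app g h j i k hj hi hjk, g.comm_first j i hj e]
      simp

/-- The diagonal of a zigzag map followed by the component of a second one is the diagonal of the
composite. -/
theorem diag_comp_app (x : Fin (Z.len + 1)) (k : Fin W.len) (l : Fin Y.len) (hl : h.sing k = l)
    (hx) (hx') : diag g x k hx ≫ h.app k l hl = diag (g ≫ h) x l hx' := by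
  subst hl
  rcases hx.eq_or with rfl | ⟨i, rfl, hi⟩
  · rw [diag_eq_b g rfl, Category.assoc, ← diag_succ h k _ rfl (Delta.regOver_succ rfl),
      ← diag_comp_rev g h k.succ _ _ hx']
    simp
  · have hi' : (g ≫ h).sing i = h.sing k := congrArg h.sing hi
    rw [diag_castSucc g i k hi, diag_castSucc (g ≫ h) i (h.sing k) hi',
      comp_app g h i k _ hi rfl hi', Category.assoc]

/-- A zigzag map `W ⟶ Y` over `u` can be recognized along a single zigzag map `a` into `W`: it
suffices that the components `w` carry the diagonals of `a` to the diagonals of some zigzag map `b`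
into `Y`. The regular objects and all the squares of `W` and `Y` are visible in the diagonals. -/
def factor (a : Z ⟶ W) (b : Z ⟶ Y) (u : Fin W.len →o Fin Y.len) (hu : u.comp a.sing = b.sing)
    (w : ∀ (k : Fin W.len) (l : Fin Y.len), u k = l → (W.s k ⟶ Y.s l))
    (hw : ∀ k l hk x hx hx', diag a x k hx ≫ w k l hk = diag b x l hx') : W ⟶ Y where
  sing := u
  app := w
  reg_eq x := by rw [b.reg_eq, ← hu, Delta.rev_comp, a.reg_eq]
  comm_empty l h := b.comm_empty l (by rw [← hu, Delta.rev_comp, Delta.rev_comp, h])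
  comm_first k l hk h := by
    have e : Delta.rev a.sing k.castSucc = Delta.rev b.sing l.castSucc := by
      rw [← hu, Delta.rev_comp, h]
    have h1 := hw k l hk _ (Delta.regOver_rev_castSucc _ k) (e ▸ Delta.regOver_rev_castSucc _ l)
    rw [diag_eq_f a rfl, diag_eq_f b e, Category.assoc, eqToHom_comp_iff] at h1
    rw [h1]
    simp
  comm_last k l hk h := by
    have e : Delta.rev a.sing k.succ = Delta.rev b.sing l.succ := by
      rw [← hu, Delta.rev_comp, h]
    have h1 := hw k l hk _ (Delta.regOver_rev_succ _ k) (e ▸ Delta.regOver_rev_succ _ l)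
    rw [diag_eq_b a rfl, diag_eq_b b e, Category.assoc, eqToHom_comp_iff] at h1
    rw [h1]
    simp
  comm_mid k k' l hk hk' h := by
    have hx : Delta.RegOver b.sing l (Delta.rev a.sing k.succ) :=
      hu ▸ (Delta.regOver_succ hk).comp_rev a.sing
    have h1 := hw k l hk _ (Delta.regOver_rev_succ _ k) hx
    have h2 := hw k' l hk' (Delta.rev a.sing k.succ) (h ▸ Delta.regOver_rev_castSucc _ k') hx
    rw [← h2, diag_eq_b a rfl, diag_eq_f a (congrArg _ h), Category.assoc, eqToHom_comp_iff] at h1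
    rw [h1]
    simp

end diag

end ZigzagIn

/-! ### Cocones under the deconstruction of a restricted diagram -/

namespace ZigzagIn

variable {C : Type u} [Category.{v} C] {J : Type u₁} [Category.{v₁} J] {D : J ⥤ ZigzagIn C}
  {c : Cocone (D ⋙ S C)} {k : Fin c.pt.len}

section unshift

/-- The index in the restricted zigzag `(restrictedDiagram c k).obj j` of a singular height of
`D(j)` over `k`. -/
def singIdx (j : J) (i : Fin (D.obj j).len) (h : leg c j i = k) :
    Fin ((restrictedDiagram c k).obj j).len :=
  ⟨i.val - (Delta.rev (leg c j) k.castSucc).val, by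
    have h1 := (Delta.rev_le_castSucc (leg c j) k.castSucc i).2 (by simp [h])
    have h2 := (Delta.lt_rev (leg c j) k.succ i).2 (by simp [h])
    change _ < (Delta.rev (leg c j) k.succ).val - (Delta.rev (leg c j) k.castSucc).val
    omega⟩

/-- The index in the restricted zigzag `(restrictedDiagram c k).obj j` of a regular height of
`D(j)` over `k`. -/
def regIdx (j : J) (x : Fin ((D.obj j).len + 1)) (hx : Delta.RegOver (leg c j) k x) :
    Fin (((restrictedDiagram c k).obj j).len + 1) :=
  ⟨x.val - (Delta.rev (leg c j) k.castSucc).val, by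
    have h1 : _ ≤ x.val := hx.1
    have h2 : x.val ≤ _ := hx.2
    change _ < (Delta.rev (leg c j) k.succ).val - (Delta.rev (leg c j) k.castSucc).val + 1
    omega⟩

/-- The regular height of `D(j)` at the index `y` of the restricted zigzag. -/
def unshiftReg (j : J) (y : Fin (((restrictedDiagram c k).obj j).len + 1)) :
    Fin ((D.obj j).len + 1) :=
  ⟨(Delta.rev (leg c j) k.castSucc).val + y.val, by
    have h1 : y.val < (Delta.rev (leg c j) k.succ).val - (Delta.rev (leg c j) k.castSucc).val + 1 :=
      y.2
    have h2 : (Delta.rev (leg c j) k.castSucc).val ≤ (Delta.rev (leg c j) k.succ).val :=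
      Delta.rev_castSucc_le_rev_succ _ k
    have h3 := (Delta.rev (leg c j) k.succ).2
    omega⟩

/-- The singular height of `D(j)` at the index `i` of the restricted zigzag. -/
def unshiftSing (j : J) (i : Fin ((restrictedDiagram c k).obj j).len) : Fin (D.obj j).len :=
  ⟨(Delta.rev (leg c j) k.castSucc).val + i.val, by
    have h1 : i.val < (Delta.rev (leg c j) k.succ).val - (Delta.rev (leg c j) k.castSucc).val := i.2
    have h3 := (Delta.rev (leg c j) k.succ).2
    omega⟩

theorem regOver_unshiftReg (j : J) (y : Fin (((restrictedDiagram c k).obj j).len + 1)) :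
    Delta.RegOver (leg c j) k (unshiftReg j y) := by
  have h1 : y.val < (Delta.rev (leg c j) k.succ).val - (Delta.rev (leg c j) k.castSucc).val + 1 :=
    y.2
  have h2 : (Delta.rev (leg c j) k.castSucc).val ≤ (Delta.rev (leg c j) k.succ).val :=
    Delta.rev_castSucc_le_rev_succ _ k
  constructor <;> simp only [Fin.le_def, unshiftReg] <;> omega

theorem leg_unshiftSing (j : J) (i : Fin ((restrictedDiagram c k).obj j).len) :
    leg c j (unshiftSing j i) = k := by
  have h1 : i.val < (Delta.rev (leg c j) k.succ).val - (Delta.rev (leg c j) k.castSucc).val := i.2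
  refine Delta.RegOver.apply_eq (regOver_unshiftReg j i.castSucc) ?_
  change (Delta.rev (leg c j) k.castSucc).val + i.val < (Delta.rev (leg c j) k.succ).val
  omega

theorem unshiftReg_regIdx (j : J) (x : Fin ((D.obj j).len + 1))
    (hx : Delta.RegOver (leg c j) k x) : unshiftReg j (regIdx j x hx) = x :=
  Fin.ext (Nat.add_sub_cancel' hx.1)

theorem unshiftSing_singIdx (j : J) (i : Fin (D.obj j).len) (h : leg c j i = k) :
    unshiftSing j (singIdx j i h) = i :=
  Fin.ext (Nat.add_sub_cancel' ((Delta.rev_le_castSucc (leg c j) k.castSucc i).2 (by simp [h])))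

theorem regIdx_unshiftReg (j : J) (y : Fin (((restrictedDiagram c k).obj j).len + 1)) (hx) :
    regIdx j (unshiftReg j y) hx = y :=
  Fin.ext (Nat.add_sub_cancel_left ..)

theorem singIdx_unshiftSing (j : J) (i : Fin ((restrictedDiagram c k).obj j).len) (h) :
    singIdx j (unshiftSing j i) h = i :=
  Fin.ext (Nat.add_sub_cancel_left ..)

theorem sing_unshiftSing {j j' : J} (φ : j ⟶ j') (i : Fin ((restrictedDiagram c k).obj j).len) :
    (D.map φ).sing (unshiftSing j i) =
      unshiftSing j' (((restrictedDiagram c k).map φ).sing i) :=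
  (Fin.ext (restrict_sing_val (D.map φ) (Delta.rev_castSucc_le_rev_succ _ k)
    (Delta.rev_castSucc_le_rev_succ _ k) (rev_leg c φ k.castSucc) (rev_leg c φ k.succ)
    i (unshiftSing j i).2)).symm

theorem rev_unshiftReg {j j' : J} (φ : j ⟶ j')
    (y : Fin (((restrictedDiagram c k).obj j').len + 1)) :
    Delta.rev (D.map φ).sing (unshiftReg j' y) =
      unshiftReg j (Delta.rev ((restrictedDiagram c k).map φ).sing y) :=
  (Fin.ext (restrict_rev (D.map φ) (Delta.rev_castSucc_le_rev_succ _ k)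
    (Delta.rev_castSucc_le_rev_succ _ k) (rev_leg c φ k.castSucc) (rev_leg c φ k.succ)
    y (unshiftReg j' y).2)).symm

variable (p : Cocone (deconstruction (restrictedDiagram c k)))

/-- The leg of a cocone under `(D_k)^*` at a regular height of `D(j)` over `k`, indexed by the
heights of `D(j)` instead of those of the restricted zigzag. -/
def legReg (j : J) (x : Fin ((D.obj j).len + 1)) (hx : Delta.RegOver (leg c j) k x) :
    (D.obj j).r x ⟶ p.pt :=
  eqToHom (congrArg (D.obj j).r (unshiftReg_regIdx j x hx).symm) ≫ regLeg p j (regIdx j x hx)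

/-- The leg of a cocone under `(D_k)^*` at a singular height of `D(j)` over `k`, indexed by the
heights of `D(j)` instead of those of the restricted zigzag. -/
def legSing (j : J) (i : Fin (D.obj j).len) (h : leg c j i = k) : (D.obj j).s i ⟶ p.pt :=
  eqToHom (congrArg (D.obj j).s (unshiftSing_singIdx j i h).symm) ≫ singLeg p j (singIdx j i h)

theorem legReg_congr (j : J) {x y : Fin ((D.obj j).len + 1)} (e : x = y) (hx hy) :
    legReg p j x hx = eqToHom (congrArg (D.obj j).r e) ≫ legReg p j y hy := by
  subst e
  simp

theorem legReg_eq (j : J) {x : Fin ((D.obj j).len + 1)} (hx)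
    (y : Fin (((restrictedDiagram c k).obj j).len + 1)) (e : x = unshiftReg j y) :
    legReg p j x hx = eqToHom (congrArg (D.obj j).r e) ≫ regLeg p j y := by
  subst e
  rw [legReg, regLeg_congr p j (regIdx_unshiftReg j y hx)]
  exact eqToHom_trans_assoc _ _ _

theorem legSing_eq (j : J) {i : Fin (D.obj j).len} (h)
    (y : Fin ((restrictedDiagram c k).obj j).len) (e : i = unshiftSing j y) :
    legSing p j i h = eqToHom (congrArg (D.obj j).s e) ≫ singLeg p j y := by
  subst e
  have aux : ∀ y' (e : y' = y), singLeg p j y' =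
      eqToHom (congrArg ((restrictedDiagram c k).obj j).s e) ≫ singLeg p j y := by
    rintro _ rfl
    simp
  rw [legSing, aux _ (singIdx_unshiftSing j y h)]
  exact eqToHom_trans_assoc _ _ _

theorem legReg_unshiftReg (j : J) (y : Fin (((restrictedDiagram c k).obj j).len + 1)) (hx) :
    legReg p j (unshiftReg j y) hx = regLeg p j y :=
  (legReg_eq p j hx y rfl).trans (Category.id_comp _)

theorem legSing_unshiftSing (j : J) (y : Fin ((restrictedDiagram c k).obj j).len) (h) :
    legSing p j (unshiftSing j y) h = singLeg p j y :=
  (legSing_eq p j h y rfl).trans (Category.id_comp _)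

theorem f_legSing (j : J) (i : Fin (D.obj j).len) (h : leg c j i = k) (hx) :
    (D.obj j).f i ≫ legSing p j i h = legReg p j i.castSucc hx := by
  have e := (unshiftSing_singIdx j i h).symm
  rw [legReg_eq p j hx (singIdx j i h).castSucc (congrArg Fin.castSucc e)]
  exact f_comp_eq (D.obj j) e _ _ (f_singLeg p j _)

theorem b_legSing (j : J) (i : Fin (D.obj j).len) (h : leg c j i = k) (hx) :
    (D.obj j).b i ≫ legSing p j i h = legReg p j i.succ hx := by
  have e := (unshiftSing_singIdx j i h).symm
  rw [legReg_eq p j hx (singIdx j i h).succ (congrArg Fin.succ e)]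
  exact b_comp_eq (D.obj j) e _ _ (b_singLeg p j _)

theorem app_legSing {j j' : J} (φ : j ⟶ j') (i : Fin (D.obj j).len) (i' : Fin (D.obj j').len)
    (e : (D.map φ).sing i = i') (h : leg c j i = k) (h' : leg c j' i' = k) :
    (D.map φ).app i i' e ≫ legSing p j' i' h' = legSing p j i h := by
  have e1 := (unshiftSing_singIdx j i h).symm
  have e2 := (unshiftSing_singIdx j' i' h').symm
  have e3 : ((restrictedDiagram c k).map φ).sing (singIdx j i h) = singIdx j' i' h' := by
    refine Fin.ext (Nat.add_left_cancel (congrArg Fin.val (sing_unshiftSing φ _).symm |>.trans ?_))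
    exact congrArg Fin.val ((congrArg (D.map φ).sing e1.symm).trans (e.trans e2))
  exact app_comp_eq (D.map φ) e1 e2 e _ _ _ (app_singLeg p φ _ _ e3)

theorem eqToHom_legReg {j j' : J} (φ : j ⟶ j') (x' : Fin ((D.obj j').len + 1)) (hx hx') :
    eqToHom ((D.map φ).reg_eq x') ≫ legReg p j (Delta.rev (D.map φ).sing x') hx =
      legReg p j' x' hx' := by
  have e1 := unshiftReg_regIdx j' x' hx'
  have e2 : Delta.rev ((restrictedDiagram c k).map φ).sing (regIdx j' x' hx') =
      regIdx j (Delta.rev (D.map φ).sing x') hx := by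
    refine Fin.ext (Nat.add_left_cancel (congrArg Fin.val (rev_unshiftReg φ _).symm |>.trans ?_))
    exact congrArg Fin.val ((congrArg (Delta.rev (D.map φ).sing) e1).trans
      (unshiftReg_regIdx j _ hx).symm)
  rw [legReg, legReg, ← eqToHom_regLeg p φ _ _ e2]
  exact (eqToHom_trans_assoc _ _ _).trans (eqToHom_trans_assoc _ _ _).symm

/-- Cocones under `(D_k)^*` in terms of the heights of the zigzags `D(j)` over `k`. -/
def mkCocone {T : C}
    (lr : ∀ (j : J) (x : Fin ((D.obj j).len + 1)), Delta.RegOver (leg c j) k x →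
      ((D.obj j).r x ⟶ T))
    (ls : ∀ (j : J) (i : Fin (D.obj j).len), leg c j i = k → ((D.obj j).s i ⟶ T))
    (hf : ∀ j i h hx, (D.obj j).f i ≫ ls j i h = lr j i.castSucc hx)
    (hb : ∀ j i h hx, (D.obj j).b i ≫ ls j i h = lr j i.succ hx)
    (hs : ∀ (j j' : J) (φ : j ⟶ j') i i' e h h', (D.map φ).app i i' e ≫ ls j' i' h' = ls j i h)
    (hr : ∀ (j j' : J) (φ : j ⟶ j') x x' (e : Delta.rev (D.map φ).sing x' = x) hx hx',
      eqToHom (((D.map φ).reg_eq x').trans (congrArg (D.obj j).r e)) ≫ lr j x hx = lr j' x' hx') :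
    Cocone (deconstruction (restrictedDiagram c k)) where
  pt := T
  ι := Paths.liftNatTrans
    (fun a => match a with
      | .reg j y => lr j (unshiftReg j y) (regOver_unshiftReg j y)
      | .sing j y => ls j (unshiftSing j y) (leg_unshiftSing j y))
    (by
      intro X Y (e : DeconHom _ X Y)
      have h' : (deconstruction (restrictedDiagram c k)).map ((Paths.of _).map e) =
        (deconPrefunctor (restrictedDiagram c k)).map e :=
        Paths.lift_toPath (deconPrefunctor (restrictedDiagram c k)) e
      refine Eq.trans (congrArg (fun t => t ≫ _) h') (Eq.trans ?_ (Category.comp_id _).symm)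
      cases e with
      | fwd j i => exact hf j (unshiftSing j i) _ _
      | bwd j i => exact hb j (unshiftSing j i) _ _
      | sing φ i => exact hs _ _ φ (unshiftSing _ i) _ (sing_unshiftSing φ i) _ _
      | reg φ x => exact hr _ _ φ _ (unshiftReg _ x) (rev_unshiftReg φ x) _ _)

section mkCocone

variable {T : C}
  {lr : ∀ (j : J) (x : Fin ((D.obj j).len + 1)), Delta.RegOver (leg c j) k x →
    ((D.obj j).r x ⟶ T)}
  {ls : ∀ (j : J) (i : Fin (D.obj j).len), leg c j i = k → ((D.obj j).s i ⟶ T)}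
  {hf hb hs hr}

theorem legReg_mkCocone (j : J) (x : Fin ((D.obj j).len + 1)) (hx) :
    legReg (mkCocone (k := k) lr ls hf hb hs hr) j x hx = lr j x hx := by
  have e := (unshiftReg_regIdx j x hx).symm
  have aux : ∀ y (e : x = y) (hy), eqToHom (congrArg (D.obj j).r e) ≫ lr j y hy = lr j x hx := by
    rintro _ rfl _
    simp
  exact aux _ e _

theorem legSing_mkCocone (j : J) (i : Fin (D.obj j).len) (h) :
    legSing (mkCocone (k := k) lr ls hf hb hs hr) j i h = ls j i h := by
  have e := (unshiftSing_singIdx j i h).symm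
  have aux : ∀ y (e : i = y) (hy), eqToHom (congrArg (D.obj j).s e) ≫ ls j y hy = ls j i h := by
    rintro _ rfl _
    simp
  exact aux _ e _

end mkCocone

variable {p}

/-- A morphism out of the vertex of a cocone under `(D_k)^*` that respects the legs at the heights
of the `D(j)` over `k` respects all legs. -/
theorem ι_comp_eq (p' : Cocone (deconstruction (restrictedDiagram c k))) (g : p.pt ⟶ p'.pt)
    (hr : ∀ j x hx, legReg p j x hx ≫ g = legReg p' j x hx)
    (hs : ∀ j i h, legSing p j i h ≫ g = legSing p' j i h) (a) :
    p.ι.app a ≫ g = p'.ι.app a := by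
  cases (a : DeconObj _) with
  | reg j y =>
    have h := hr j (unshiftReg j y) (regOver_unshiftReg j y)
    rwa [legReg_unshiftReg, legReg_unshiftReg] at h
  | sing j y =>
    have h := hs j (unshiftSing j y) (leg_unshiftSing j y)
    rwa [legSing_unshiftSing, legSing_unshiftSing] at h

theorem legReg_comp (p' : Cocone (deconstruction (restrictedDiagram c k))) (g : p.pt ⟶ p'.pt)
    (h : ∀ a, p.ι.app a ≫ g = p'.ι.app a) (j : J) (x : Fin ((D.obj j).len + 1)) (hx) :
    legReg p j x hx ≫ g = legReg p' j x hx :=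
  (Category.assoc _ _ _).trans (congrArg (_ ≫ ·) (h _))

theorem legSing_comp (p' : Cocone (deconstruction (restrictedDiagram c k))) (g : p.pt ⟶ p'.pt)
    (h : ∀ a, p.ι.app a ≫ g = p'.ι.app a) (j : J) (i : Fin (D.obj j).len) (hi) :
    legSing p j i hi ≫ g = legSing p' j i hi :=
  (Category.assoc _ _ _).trans (congrArg (_ ≫ ·) (h _))

end unshift

end ZigzagIn

namespace ZigzagIn

variable {C : Type u} [Category.{v} C] {J : Type u₁} [Category.{v₁} J] {D : J ⥤ ZigzagIn C}

/-! ### Inducing and gluing cocones -/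

section diagCocone

variable {c : Cocone (D ⋙ S C)} {Y : ZigzagIn C} (q : ∀ j, D.obj j ⟶ Y)
  (hq : ∀ {j j' : J} (φ : j ⟶ j'), D.map φ ≫ q j' = q j)
  (u : Fin c.pt.len →o Fin Y.len) (hu : ∀ j, u.comp (leg c j) = (q j).sing)

/-- A cocone under `D` with vertex `Y`, whose singular heights factor through `c` by a map `u`,
gives a cocone under each `(D_k)^*` with vertex the singular object of `Y` at `u k`: its legs at
singular heights are the components of the zigzag maps, its legs at regular heights are their
diagonals. -/
def diagCocone (k : Fin c.pt.len) : Cocone (deconstruction (restrictedDiagram c k)) :=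
  mkCocone (T := Y.s (u k))
    (fun j x hx => diag (q j) x (u k) (hu j ▸ hx.comp rfl))
    (fun j i h => (q j).app i (u k) (hu j ▸ congrArg u h))
    (fun j i _ _ => (diag_castSucc (q j) i _ _ _).symm)
    (fun j i _ _ => (diag_succ (q j) i _ _ _).symm)
    (fun j j' φ i i' e h h' =>
      (comp_app (D.map φ) (q j') i i' (u k) e _ (hq φ ▸ hu j ▸ congrArg u h)).symm.trans
        (app_congr (hq φ) i (u k) _ _))
    (fun j j' φ x x' e hx hx' => by
      subst e
      rw [← diag_comp_rev (D.map φ) (q j') x' (u k) _ (hq φ ▸ hu j ▸ hx.comp rfl),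
        diag_congr_map (hq φ)])

theorem legReg_diagCocone (k : Fin c.pt.len) (j : J) (x : Fin ((D.obj j).len + 1)) (hx) (hx') :
    legReg (diagCocone q hq u hu k) j x hx = diag (q j) x (u k) hx' :=
  legReg_mkCocone ..

theorem legSing_diagCocone (k : Fin c.pt.len) (j : J) (i : Fin (D.obj j).len) (h) (h') :
    legSing (diagCocone q hq u hu k) j i h = (q j).app i (u k) h' :=
  legSing_mkCocone ..

end diagCocone

section connected

variable [IsConnected J] (c : Cocone (D ⋙ S C))
  (t : ∀ k : Fin c.pt.len, Cocone (deconstruction (restrictedDiagram c k))) (j₀ : J)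

variable {c} in
/-- By connectedness, the legs of a cocone under `(D_k)^*` at the regular heights assigned to a
fixed regular height `y` of `c` agree. This is applied to the two ends of the height `k`. -/
theorem legReg_rev {k : Fin c.pt.len} (p : Cocone (deconstruction (restrictedDiagram c k)))
    (y : Fin (c.pt.len + 1)) (hy : ∀ j, Delta.RegOver (leg c j) k (Delta.rev (leg c j) y))
    (j j' : J) :
    legReg p j (Delta.rev (leg c j) y) (hy j) =
      eqToHom (ProcedureRun.r_eq c j j' y) ≫ legReg p j' (Delta.rev (leg c j') y) (hy j') := by
  have h := constant_of_preserves_morphisms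
    (fun i => eqToHom (ProcedureRun.r_eq c j i y) ≫
      legReg p i (Delta.rev (leg c i) y) (hy i))
    (fun j₁ j₂ φ => by
      have e := rev_leg c φ y
      rw [← eqToHom_legReg p φ (Delta.rev (leg c j₂) y) (e ▸ hy j₁) (hy j₂),
        legReg_congr p j₁ e _ (hy j₁)]
      simp) j j'
  simpa using h

/-- The zigzag glued from the vertices of arbitrary cocones `t k` under the `(D_k)^*`, with the legs
at the two ends of the height `k` as its maps. -/
def glue : ZigzagIn C where
  len := c.pt.len
  r x := (D.obj j₀).r (Delta.rev (leg c j₀) x)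
  s k := (t k).pt
  f k := legReg (t k) j₀ _ (Delta.regOver_rev_castSucc _ k)
  b k := legReg (t k) j₀ _ (Delta.regOver_rev_succ _ k)

theorem glue_f (k : Fin c.pt.len) (j : J) {x : Fin ((D.obj j).len + 1)}
    (e : Delta.rev (leg c j) k.castSucc = x) (hx) :
    (glue c t j₀).f k = eqToHom ((ProcedureRun.r_eq c j₀ j _).trans (congrArg (D.obj j).r e)) ≫
      legReg (t k) j x hx := by
  subst e
  exact legReg_rev (t k) k.castSucc (fun _ => Delta.regOver_rev_castSucc _ k) j₀ j

theorem glue_b (k : Fin c.pt.len) (j : J) {x : Fin ((D.obj j).len + 1)}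
    (e : Delta.rev (leg c j) k.succ = x) (hx) :
    (glue c t j₀).b k = eqToHom ((ProcedureRun.r_eq c j₀ j _).trans (congrArg (D.obj j).r e)) ≫
      legReg (t k) j x hx := by
  subst e
  exact legReg_rev (t k) k.succ (fun _ => Delta.regOver_rev_succ _ k) j₀ j

/-- The zigzag map from `D(j)` to the glued zigzag, given by the legs of the cocones `t k`. -/
def glueLeg (j : J) : D.obj j ⟶ glue c t j₀ where
  sing := leg c j
  app i k h := legSing (t k) j i h
  reg_eq := ProcedureRun.r_eq c j₀ j
  comm_empty k h := by
    rw [glue_f c t j₀ k j h (Delta.regOver_rev_succ _ k),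
      glue_b c t j₀ k j rfl (Delta.regOver_rev_succ _ k)]
    exact (eqToHom_trans_assoc _ _ _).symm
  comm_first i k hi h := (glue_f c t j₀ k j h (Delta.regOver_castSucc hi)).trans
    (congrArg (_ ≫ ·) (f_legSing (t k) j i hi _).symm)
  comm_last i k hi h := (glue_b c t j₀ k j h (Delta.regOver_succ hi)).trans
    (congrArg (_ ≫ ·) (b_legSing (t k) j i hi _).symm)
  comm_mid i i' k hi hi' h := (b_legSing (t k) j i hi (Delta.regOver_succ hi)).trans
    ((legReg_congr (t k) j h _ (Delta.regOver_castSucc hi')).trans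
      (congrArg (_ ≫ ·) (f_legSing (t k) j i' hi' _).symm))

theorem map_glueLeg {j j' : J} (φ : j ⟶ j') :
    D.map φ ≫ glueLeg c t j₀ j' = glueLeg c t j₀ j :=
  hom_ext _ _ (DFunLike.congr_fun (leg_comp c φ)) fun i k hk hk' =>
    (comp_app (D.map φ) (glueLeg c t j₀ j') i _ k rfl hk hk).trans
      (app_legSing (t k) φ i _ rfl hk' hk)

/-- The cocone under `D` with vertex the glued zigzag. -/
def glueCocone : Cocone D where
  pt := glue c t j₀
  ι :=
    { app := glueLeg c t j₀
      naturality := fun _ _ φ => (map_glueLeg c t j₀ φ).trans (Category.comp_id _).symm }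

theorem diag_glueLeg (j : J) (x : Fin ((D.obj j).len + 1)) (k : Fin c.pt.len) (hx) :
    diag (glueLeg c t j₀ j) x k hx = legReg (t k) j x hx := by
  rcases hx.eq_or with e | ⟨i, rfl, hi⟩
  · rw [diag_eq_b (glueLeg c t j₀ j) e, glue_b c t j₀ k j e.symm hx]
    exact (eqToHom_trans_assoc _ _ _).trans (Category.id_comp _)
  · rw [diag_castSucc (glueLeg c t j₀ j) i k hi]
    exact f_legSing (t k) j i hi hx

end connected

/-! ### The constructed cocone is a colimit -/

namespace ProcedureRun

variable (R : ProcedureRun D) [IsConnected J]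

theorem diag_zigzagLeg (j : J) (x : Fin ((D.obj j).len + 1)) (k : Fin R.c.pt.len) (hx) :
    diag (R.zigzagLeg j) x k hx = legReg (R.p k) j x hx := by
  rcases hx.eq_or with e | ⟨i, rfl, hi⟩
  · have e' : x = unshiftReg j (Fin.last _) :=
      e.trans (Fin.ext (Nat.add_sub_cancel' (Delta.rev_castSucc_le_rev_succ _ k)).symm)
    rw [diag_eq_b (R.zigzagLeg j) e, R.zigzag_b k j, legReg_eq (R.p k) j hx _ e']
    exact (eqToHom_trans_assoc _ _ _)
  · rw [diag_castSucc (R.zigzagLeg j) i k hi]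
    exact f_legSing (R.p k) j i hi hx

/-- Zigzag maps out of the constructed zigzag are determined by their composites with the legs:
on singular heights since `c` is a colimit, and on singular objects since the `p k` are. -/
theorem zigzag_hom_ext {Y : ZigzagIn C} (m m' : R.zigzag ⟶ Y)
    (h : ∀ j, R.zigzagLeg j ≫ m = R.zigzagLeg j ≫ m') : m = m' := by
  have hs : (S C).map m = (S C).map m' :=
    R.hc.hom_ext fun j => congrArg (S C).map (h j)
  refine hom_ext m m' (DFunLike.congr_fun (congrArg Delta.Hom.map hs)) fun k l hk hk' => ?_
  refine (R.hp k).hom_ext fun a => ?_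
  refine ι_comp_eq ((R.p k).extend (m'.app k l hk')) (m.app k l hk) (fun j x hx => ?_)
    (fun j i hi => ?_) a
  · have e : diag (R.zigzagLeg j) x k hx ≫ m.app k l hk =
        diag (R.zigzagLeg j) x k hx ≫ m'.app k l hk' :=
      (diag_comp_app (R.zigzagLeg j) m x k l hk hx (hx.comp hk)).trans
        ((diag_congr_map (h j) x l _ (hx.comp hk')).trans
          (diag_comp_app (R.zigzagLeg j) m' x k l hk' hx (hx.comp hk')).symm)
    rw [R.diag_zigzagLeg j x k hx] at e
    exact e.trans (legReg_comp ((R.p k).extend (m'.app k l hk')) _ (fun _ => rfl) j x hx)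
  · have hm : m.sing (leg R.c j i) = l := (congrArg m.sing hi).trans hk
    have hm' : m'.sing (leg R.c j i) = l := (congrArg m'.sing hi).trans hk'
    have e := (comp_app (R.zigzagLeg j) m i k l hi hk hm).symm.trans
      ((app_congr (h j) i l hm hm').trans (comp_app (R.zigzagLeg j) m' i k l hi hk' hm'))
    exact e.trans (legSing_comp ((R.p k).extend (m'.app k l hk')) _ (fun _ => rfl) j i hi)

/-- A cocone under `D` factors through the constructed one. On singular heights the factorization
comes from the universal property of `c`; on singular objects, from that of `p k`, applied to the
cocone of diagonals. -/
theorem exists_desc (s : Cocone D) : ∃ m : R.zigzag ⟶ s.pt, ∀ j, R.zigzagLeg j ≫ m = s.ι.app j := by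
  let q : ∀ j, D.obj j ⟶ s.pt := s.ι.app
  have hq : ∀ {j j' : J} (φ : j ⟶ j'), D.map φ ≫ q j' = q j := s.w
  let u : Fin R.c.pt.len →o Fin s.pt.len := (R.hc.desc ((S C).mapCocone s)).map
  have hu : ∀ j, u.comp (leg R.c j) = (q j).sing := fun j =>
    congrArg Delta.Hom.map (R.hc.fac ((S C).mapCocone s) j)
  let w : ∀ k l, u k = l → (R.zigzag.s k ⟶ s.pt.s l) := fun k l hk =>
    (R.hp k).desc (diagCocone q hq u hu k) ≫ eqToHom (congrArg s.pt.s hk)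
  refine ⟨factor (R.zigzagLeg R.j₀) (q R.j₀) u (hu _) w ?_, fun j => ?_⟩
  · rintro k _ rfl x hx hx'
    refine (congrArg (· ≫ w k (u k) rfl) (R.diag_zigzagLeg R.j₀ x k hx)).trans ?_
    refine (congrArg (_ ≫ ·) (Category.comp_id _)).trans ?_
    refine (legReg_comp _ _ ((R.hp k).fac _) R.j₀ x hx).trans ?_
    exact legReg_diagCocone q hq u hu k R.j₀ x hx hx'
  · refine hom_ext _ _ (DFunLike.congr_fun (hu j)) fun i l hl hl' => ?_
    have e : u (leg R.c j i) = l := hl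
    subst e
    refine (comp_app (R.zigzagLeg j) _ i _ _ rfl rfl hl).trans ?_
    refine (congrArg (_ ≫ ·) (Category.comp_id _)).trans ?_
    refine (legSing_comp _ _ ((R.hp _).fac _) j i rfl).trans ?_
    exact legSing_diagCocone q hq u hu _ j i rfl hl'

theorem nonempty_isColimit_cocone : Nonempty (IsColimit R.cocone) := by
  refine ⟨IsColimit.ofExistsUnique fun s => ?_⟩
  obtain ⟨m, hm⟩ := R.exists_desc s
  exact ⟨m, hm, fun m' hm' => R.zigzag_hom_ext m' m fun j => (hm' j).trans (hm j).symm⟩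

end ProcedureRun

end ZigzagIn

namespace ZigzagIn

variable {C : Type u} [Category.{v} C] {J : Type u₁} [Category.{v₁} J] {D : J ⥤ ZigzagIn C}

/-! ### Carrying out the procedure -/

/-- The legs of a colimit in `Delta` are jointly surjective: the two monotone maps that duplicate an
element `k` and send it to the first, respectively the second, copy differ only at `k`. -/
theorem exists_leg_eq {c : Cocone (D ⋙ S C)} (hc : IsColimit c) (k : Fin c.pt.len) :
    ∃ j i, leg c j i = k := by
  by_contra! hk
  let α (p : Fin (c.pt.len + 1)) : c.pt ⟶ (⟨c.pt.len + 1⟩ : Delta) :=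
    ⟨(Fin.succAboveOrderEmb p).toOrderHom⟩
  have h : α k.succ = α k.castSucc := hc.hom_ext fun j => Delta.Hom.ext <| OrderHom.ext _ _ <| by
    funext i
    change k.succ.succAbove (leg c j i) = k.castSucc.succAbove (leg c j i)
    rcases lt_or_gt_of_ne (hk j i) with hlt | hlt
    · rw [Fin.succAbove_castSucc_of_lt _ _ hlt, Fin.succAbove_succ_of_le _ _ hlt.le]
    · rw [Fin.succAbove_castSucc_of_le _ _ hlt.le, Fin.succAbove_succ_of_lt _ _ hlt]
  have h' : k.succ.succAbove k = k.castSucc.succAbove k :=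
    DFunLike.congr_fun (congrArg Delta.Hom.map h) k
  rw [Fin.succAbove_succ_self, Fin.succAbove_castSucc_self] at h'
  exact Fin.castSucc_lt_succ.ne h'

theorem exists_procedureRun [Nonempty J] (c : Cocone (D ⋙ S C)) (hc : IsColimit c)
    (h : ∀ k : Fin c.pt.len, HasColimit (deconstruction (restrictedDiagram c k))) :
    ∃ R : ProcedureRun D, R.c = c := by
  have hj : ∀ k : Fin c.pt.len, ∃ j, 0 < ((restrictedDiagram c k).obj j).len := fun k => by
    obtain ⟨j, i, hi⟩ := exists_leg_eq hc k
    exact ⟨j, Fin.pos (singIdx j i hi)⟩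
  choose j hj using hj
  exact ⟨⟨c, hc, fun k => colimit.cocone _, fun k => colimit.isColimit _, j, hj,
    Classical.arbitrary J⟩, rfl⟩

/-! ### Necessity of the colimits -/

section factorGlue

variable [IsConnected J] {c : Cocone (D ⋙ S C)}

/-- A zigzag map into a glued zigzag, out of the vertex `Y` of a cocone under `D`, can be given by
components that carry the legs and the diagonals of `Y` to the legs of the glued cocones. -/
theorem exists_hom_glue (t : ∀ k : Fin c.pt.len, Cocone (deconstruction (restrictedDiagram c k)))
    (j₀ : J) {Y : ZigzagIn C} (q : ∀ j, D.obj j ⟶ Y) (v : Fin Y.len →o Fin c.pt.len)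
    (hv : ∀ j, v.comp (q j).sing = leg c j) (w : ∀ i l, v i = l → (Y.s i ⟶ (t l).pt))
    (hr : ∀ j i l hi x hx hx', diag (q j) x i hx ≫ w i l hi = legReg (t l) j x hx')
    (hs : ∀ j y i l hy hi hy', (q j).app y i hy ≫ w i l hi = legSing (t l) j y hy') :
    ∃ m : Y ⟶ glue c t j₀, m.sing = v ∧ (∀ i l h h', m.app i l h = w i l h') ∧
      ∀ j, q j ≫ m = glueLeg c t j₀ j := by
  refine ⟨factor (q j₀) (glueLeg c t j₀ j₀) v (hv j₀) w ?_, rfl, fun _ _ _ _ => rfl, fun j => ?_⟩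
  · intro i l hi x hx hx'
    exact (hr j₀ i l hi x hx hx').trans (diag_glueLeg c t j₀ j₀ x l hx').symm
  · refine hom_ext _ _ (DFunLike.congr_fun (hv j)) fun y l hl hl' => ?_
    exact (comp_app (q j) _ y _ l rfl hl hl).trans (hs j y _ l rfl hl hl')

end factorGlue

section isColimit

variable [HasTerminal C]

/-- The cocone with terminal vertex. -/
noncomputable def terminalCocone {I : Type*} [Category* I] (F : I ⥤ C) : Cocone F where
  pt := ⊤_ C
  ι := { app := fun _ => terminal.from _ }

variable [IsConnected J] {K : Cocone D}

/-- Monotone maps out of the singular heights of a colimit are determined by their composites with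
the legs, because they lift to zigzag maps into a zigzag with terminal singular objects. -/
theorem sing_hom_ext (hK : IsColimit K) (c : Cocone (D ⋙ S C))
    (v v' : Fin K.pt.len →o Fin c.pt.len)
    (hv : ∀ j, v.comp (K.ι.app j).sing = leg c j)
    (hv' : ∀ j, v'.comp (K.ι.app j).sing = leg c j) : v = v' := by
  let j₀ : J := Classical.arbitrary J
  have lift : ∀ v : Fin K.pt.len →o Fin c.pt.len, (∀ j, v.comp (K.ι.app j).sing = leg c j) →
      ∃ m : K.pt ⟶ glue c (fun k => terminalCocone _) j₀, m.sing = v ∧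
        ∀ j, K.ι.app j ≫ m = glueLeg c (fun k => terminalCocone _) j₀ j := fun v hv => by
    obtain ⟨m, h1, -, h2⟩ := exists_hom_glue (fun k => terminalCocone _) j₀ (fun j => K.ι.app j) v
      hv (fun _ _ _ => terminal.from _) (fun _ _ _ _ _ _ _ => terminal.hom_ext _ _)
      (fun _ _ _ _ _ _ _ => terminal.hom_ext _ _)
    exact ⟨m, h1, h2⟩
  obtain ⟨m, rfl, hm⟩ := lift v hv
  obtain ⟨m', rfl, hm'⟩ := lift v' hv'
  rw [hK.hom_ext fun j => (hm j).trans (hm' j).symm]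

/-- The functor of singular heights preserves colimits of connected diagrams. -/
theorem nonempty_isColimit_mapCocone (hK : IsColimit K) :
    Nonempty (IsColimit ((S C).mapCocone K)) := by
  refine ⟨IsColimit.ofExistsUnique fun c => ?_⟩
  let s := glueCocone c (fun k => terminalCocone _) (Classical.arbitrary J)
  refine ⟨(S C).map (hK.desc s), fun j => congrArg (S C).map (hK.fac s j), fun v hv => ?_⟩
  exact Delta.Hom.ext (sing_hom_ext hK c v.map _ (fun j => congrArg Delta.Hom.map (hv j))
    fun j => congrArg Hom.sing (hK.fac s j))

/-- The singular object over `k` of a colimit of `D` is a colimit of `(D_k)^*`. The morphism to the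
vertex of another cocone is a component of the zigzag map to the zigzag glued from that cocone at
`k` and from cocones with terminal vertex at the other heights. -/
theorem hasColimit_deconstruction (hK : IsColimit K) {c : Cocone (D ⋙ S C)} (hc : IsColimit c)
    (k : Fin c.pt.len) : HasColimit (deconstruction (restrictedDiagram c k)) := by
  let q : ∀ j, D.obj j ⟶ K.pt := K.ι.app
  have hq : ∀ {j j' : J} (φ : j ⟶ j'), D.map φ ≫ q j' = q j := K.w
  obtain ⟨hS⟩ := nonempty_isColimit_mapCocone hK
  let e := hc.coconePointUniqueUpToIso hS
  let u : Fin c.pt.len →o Fin K.pt.len := e.hom.map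
  let v : Fin K.pt.len →o Fin c.pt.len := e.inv.map
  have hu : ∀ j, u.comp (leg c j) = (q j).sing := fun j =>
    congrArg Delta.Hom.map (hc.comp_coconePointUniqueUpToIso_hom hS j)
  have hv : ∀ j, v.comp (q j).sing = leg c j := fun j =>
    congrArg Delta.Hom.map (hc.comp_coconePointUniqueUpToIso_inv hS j)
  have huv : ∀ i, u (v i) = i := DFunLike.congr_fun (congrArg Delta.Hom.map e.inv_hom_id)
  have hvu : ∀ i, v (u i) = i := DFunLike.congr_fun (congrArg Delta.Hom.map e.hom_inv_id)
  refine ⟨⟨⟨diagCocone q hq u hu k, IsColimit.ofExistsUnique fun s => ?_⟩⟩⟩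
  let j₀ : J := Classical.arbitrary J
  -- The cocone `s` at the height `k`, and cocones with terminal vertex at all other heights.
  obtain ⟨t, rfl, ht⟩ : ∃ t : ∀ l : Fin c.pt.len, Cocone (deconstruction (restrictedDiagram c l)),
      t k = s ∧ ∀ l, l ≠ k → Nonempty (IsTerminal (t l).pt) :=
    ⟨Function.update (fun l => terminalCocone _) k s, Function.update_self .., fun l hl => by
      rw [Function.update_of_ne hl]
      exact ⟨terminalIsTerminal⟩⟩
  obtain ⟨m, hm⟩ : ∃ m : K.pt ⟶ glue c t j₀, ∀ j, q j ≫ m = glueLeg c t j₀ j :=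
    ⟨hK.desc (glueCocone c t j₀), hK.fac (glueCocone c t j₀)⟩
  have hmv : m.sing = v := sing_hom_ext hK c _ _ (fun j => congrArg Hom.sing (hm j)) hv
  have hmk : m.sing (u k) = k := (DFunLike.congr_fun hmv _).trans (hvu k)
  refine ⟨m.app (u k) k hmk, ι_comp_eq _ _ (fun j x hx => ?_) (fun j i hi => ?_), fun g hg => ?_⟩
  · have hx' : Delta.RegOver (q j).sing (u k) x := hu j ▸ hx.comp rfl
    refine (congrArg (· ≫ m.app (u k) k hmk)
      (legReg_diagCocone q hq u hu k j x hx hx')).trans ?_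
    refine (diag_comp_app (q j) m x (u k) k hmk hx' (hx'.comp hmk)).trans ?_
    exact (diag_congr_map (hm j) x k _ hx).trans (diag_glueLeg c t j₀ j x k hx)
  · have hi' : (q j).sing i = u k := hu j ▸ congrArg u hi
    have hmi : (q j ≫ m).sing i = k := (congrArg m.sing hi').trans hmk
    refine (congrArg (· ≫ m.app (u k) k hmk)
      (legSing_diagCocone q hq u hu k j i hi hi')).trans ?_
    exact (comp_app (q j) m i _ k hi' hmk hmi).symm.trans (app_congr (hm j) i k hmi hi)
  · -- Any other solution `g` is the component at `k` of a zigzag map to the same glued zigzag.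
    have hi : ∀ {i l}, v i = l → l = k → i = u k := fun h h' => by rw [← h', ← h, huv]
    let w : ∀ i l, v i = l → (K.pt.s i ⟶ (t l).pt) := fun i l h =>
      if h' : l = k then
        eqToHom (congrArg K.pt.s (hi h h')) ≫ g ≫ eqToHom (congrArg (fun l => (t l).pt) h'.symm)
      else (ht l h').some.from _
    have hwk : ∀ h, w (u k) k h = g := fun h =>
      (dif_pos rfl).trans ((Category.id_comp _).trans (Category.comp_id _))
    obtain ⟨m', -, hm'w, hm'⟩ := exists_hom_glue t j₀ q v hv w
      (fun j i l h x hx hx' => by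
        by_cases h' : l = k
        · obtain rfl := hi h h'
          subst h'
          rw [hwk h, ← legReg_comp (t l) g hg j x hx', legReg_diagCocone q hq u hu l j x hx' hx]
          rfl
        · exact (ht l h').some.hom_ext _ _)
      (fun j y i l hy h hy' => by
        by_cases h' : l = k
        · obtain rfl := hi h h'
          subst h'
          rw [hwk h, ← legSing_comp (t l) g hg j y hy', legSing_diagCocone q hq u hu l j y hy' hy]
          rfl
        · exact (ht l h').some.hom_ext _ _)
    obtain rfl : m' = m := hK.hom_ext fun j => (hm' j).trans (hm j).symm
    exact ((hm'w (u k) k hmk (hvu k)).trans (hwk (hvu k))).symm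

end isColimit

end ZigzagIn

theorem theorem1 {C : Type u} [Category.{v} C] [HasTerminal C]
    {J : Type u₁} [Category.{v₁} J] [IsConnected J] (D : J ⥤ ZigzagIn C) :
    (HasColimit D ↔ ZigzagIn.ProcedureSucceeds D) ∧
    (∀ (c : Cocone (D ⋙ ZigzagIn.S C)) (_ : IsColimit c),
      (∀ k : Fin c.pt.len,
        HasColimit (ZigzagIn.deconstruction (ZigzagIn.restrictedDiagram c k))) →
      ∃ R : ZigzagIn.ProcedureRun D, R.c = c) ∧
    (∀ R : ZigzagIn.ProcedureRun D, Nonempty (IsColimit R.cocone)) := by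
  refine ⟨⟨fun _ => ?_, fun ⟨_, h⟩ => ?_⟩, ZigzagIn.exists_procedureRun,
    fun R => R.nonempty_isColimit_cocone⟩
  · have hK := colimit.isColimit D
    obtain ⟨hS⟩ := ZigzagIn.nonempty_isColimit_mapCocone hK
    exact ⟨⟨⟨_, hS⟩⟩, fun c hc k => ZigzagIn.hasColimit_deconstruction hK hc k⟩
  · obtain ⟨R, -⟩ := ZigzagIn.exists_procedureRun (colimit.cocone (D ⋙ ZigzagIn.S C))
      (colimit.isColimit _) (h _ (colimit.isColimit _))
    obtain ⟨hR⟩ := R.nonempty_isColimit_cocone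
    exact ⟨⟨⟨_, hR⟩⟩⟩
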